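/- Let $\mathbb N=\{1,2,\dots\}$, $\mathbb N_0=\mathbb N\cup\{0\}$, $\Omega=\{-1,1\}^{\mathbb N}$, $\Omega_0=\{-1,1\}^{\mathbb N_0}$, and let $\beta,J\in\mathbb R$ (zero magnetic field). Standard Ising model on the half-line. For $N\in\mathbb N_0$, $c\in\mathbb R$ and $s\in\{-1,1\}$ let $\mu^{\mathrm{Ising},c,s}_N$ be the probability measure on $\{-1,1\}^{[0,N]}$ with weights proportional to $$\exp\Big(\beta\Big(\sum_{i=0}^{N-1}J\sigma_i\sigma_{i+1}+c\,\sigma_N s\Big)\Big)$$ (free boundary condition on the left, boundary spin $s$ on the right), viewed as a measure on $\Omega_0$ by putting $\sigma_i=s$ for $i>N$. Multiplicative Ising model. For $N\in\mathbb N$, $c\in\mathbb R$ and $\eta\in\Omega$ let $\mu_N^{\eta}=\mu_N^{\eta,c}$ be the probability measure on $\{-1,1\}^{[1,2N]}$ with weights proportional to $$\exp\Big(\beta\Big(\sum_{i=1}^{N}J\sigma_i\sigma_{2i}+c\sum_{i=N+1}^{2N}\sigma_i\eta_{2i}\Big)\Big),$$ viewed as a measure on $\Omega$ by putting $\sigma_i=\eta_i$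 for $i>2N$. Let $U$ be the potential $U(\{i,2i\},\sigma)=-\beta J\sigma_i\sigma_{2i}$ for $i\in\mathbb N$, and $U(A,\sigma)=0$ for all other finite $A\subset\mathbb N$. A Gibbs measure for $U$ is a probability measure on $\Omega$ such that, for every finite $\Lambda\subset\mathbb N$, the conditional distribution of $\sigma$ given the spins outside $\Lambda$ is the one under which these spins stay fixed and $\sigma_\Lambda$ has weights proportional to $\exp\big(-\sum_{A\cap\Lambda\neq\emptyset}U(A,\sigma)\big)$. Then there are probability measures $\mu^{\mathrm{Ising}}_\infty$ on $\Omega_0$ and $\mu^{M}_\infty$ on $\Omega$ with the following properties. 0. For all $c\in\mathbb R$ and $s\in\{-1,1\}$, the measures $\mu^{\mathrm{Ising},c,s}_N$ converge weakly as $N\to\infty$, and $\mu^{\mathrm{Ising}}_\infty$ is their unique limit, independent of $c$ and $s$. 1. For all $c\in\mathbb R$ and $\eta\in\Omega$, the measures $\mu^{\eta,c}_N$ converge weakly as $N\to\infty$, and $\mu^M_\infty$ is their unique limit, independent of $c$ and $\eta$. Moreover, $\mu^M_\infty$ is a Gibbs measure for $U$, and it is the only one. 2. Under $\mu^M_\infty$,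 the layers $\tau^r=(\tau^r_i)_{i\in\mathbb N_0}$, $\tau^r_i=\sigma_{r2^i}$, $r$ odd, are independent, and each of them has distribution $\mu^{\mathrm{Ising}}_\infty$. 3. $\mu^M_\infty$ is multiplication invariant: for every $i\in\mathbb N$, $\sigma$ and $T_i\sigma$ have the same distribution under $\mu^M_\infty$, where $(T_i\sigma)_j=\sigma_{ij}$. -/

import Mathlib

open MeasureTheory ProbabilityTheory Filter Topology

noncomputable section

namespace MulIsing

/-- Ising spins: the two-element type `{-1, 1}`, realised as the units of `ℤ`. -/
abbrev Spin : Type := ℤˣ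

instance : DiscreteTopology Spin := by
  refine DiscreteTopology.of_continuous_injective Units.continuous_val Units.val_injective

instance : DiscreteMeasurableSpace Spin where
  forall_measurableSet s := by
    refine ⟨Units.val '' s, MeasurableSet.of_discrete, ?_⟩
    exact Set.preimage_image_eq s Units.val_injective

instance : BorelSpace Spin := inferInstance

/-- The real number `±1` represented by a spin. -/
def sv (s : Spin) : ℝ := ((s : ℤ) : ℝ)

/-- The configuration which equals `ζ` on the finite set `Λ` and `ω` off `Λ`. -/
def glue {S : Type*} [DecidableEq S] (Λ : Finset S) (ω : S → Spin) (ζ : Λ → Spin) : S → Spin :=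
  fun x => if hx : x ∈ Λ then ζ ⟨x, hx⟩ else ω x

theorem measurable_glue {S : Type*} [DecidableEq S] (Λ : Finset S) (ω : S → Spin) :
    Measurable (glue Λ ω) := by
  refine measurable_pi_lambda _ fun x => ?_
  by_cases hx : x ∈ Λ
  · simpa only [glue, hx, dite_true] using measurable_pi_apply (⟨x, hx⟩ : Λ)
  · simpa only [glue, hx, dite_false] using measurable_const

/-- The Boltzmann measure `e^{-H} / Z` on a finite set, `Z = ∑ e^{-H}`. -/
def boltzmann {X : Type*} [Fintype X] [MeasurableSpace X] (H : X → ℝ) : Measure X :=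
  ∑ x, ENNReal.ofReal (Real.exp (-H x) / ∑ y, Real.exp (-H y)) • Measure.dirac x

theorem isProbabilityMeasure_boltzmann {X : Type*} [Fintype X] [Nonempty X] [MeasurableSpace X]
    (H : X → ℝ) : IsProbabilityMeasure (boltzmann H) := by
  have hZ : 0 < ∑ y, Real.exp (-H y) :=
    Finset.sum_pos (fun _ _ => Real.exp_pos _) Finset.univ_nonempty
  refine ⟨?_⟩
  simp only [boltzmann, Measure.coe_finsetSum, Finset.sum_apply, Measure.smul_apply,
    measure_univ, smul_eq_mul, mul_one]
  rw [← ENNReal.ofReal_sum_of_nonneg fun x _ => div_nonneg (Real.exp_pos _).le hZ.le,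
    ← Finset.sum_div, div_self hZ.ne', ENNReal.ofReal_one]

/-- The finite-volume measure on the spins in `Λ` with Hamiltonian `H` (a function of the
configuration equal to the summation variable on `Λ` and to `ω` off `Λ`), normalised on
`{-1, 1}^Λ` and viewed as a probability measure on `{-1, 1}^S` by putting the fixed
configuration `ω` off `Λ`. -/
def finiteVolume {S : Type*} [DecidableEq S] (Λ : Finset S) (H : (S → Spin) → ℝ)
    (ω : S → Spin) : ProbabilityMeasure (S → Spin) :=
  ⟨(boltzmann fun ζ : Λ → Spin => H (glue Λ ω ζ)).map (glue Λ ω),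
    haveI := isProbabilityMeasure_boltzmann fun ζ : Λ → Spin => H (glue Λ ω ζ)
    Measure.isProbabilityMeasure_map (measurable_glue Λ ω).aemeasurable⟩

/-! ### Gibbs measures for a potential -/

/-- The Hamiltonian in `Λ` of the potential `U`: the sum of `U A σ` over all finite `A` that
meet `Λ`. -/
def potentialHamiltonian {S : Type*} [DecidableEq S] (U : Finset S → (S → Spin) → ℝ)
    (Λ : Finset S) (σ : S → Spin) : ℝ :=
  ∑' A : Finset S, if (A ∩ Λ).Nonempty then U A σ else 0

/-- The Gibbs specification `γ_Λ(· | ω)` of the potential `U`. -/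
def specification {S : Type*} [DecidableEq S] (U : Finset S → (S → Spin) → ℝ)
    (Λ : Finset S) (ω : S → Spin) : ProbabilityMeasure (S → Spin) :=
  finiteVolume Λ (potentialHamiltonian U Λ) ω

/-- `μ` is a Gibbs measure for `U`: for every finite `Λ`, the kernel `γ_Λ` is a version of the
conditional distribution under `μ` given the spins off `Λ`. -/
def IsGibbs {S : Type*} [DecidableEq S] (U : Finset S → (S → Spin) → ℝ)
    (μ : ProbabilityMeasure (S → Spin)) : Prop :=
  ∀ (Λ : Finset S) (A : Set (S → Spin)), MeasurableSet A →
    (μ : Measure (S → Spin))[A.indicator (fun _ => (1 : ℝ)) |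
        cylinderEvents (X := fun _ : S => Spin) ((Λ : Set S)ᶜ)]
      =ᵐ[(μ : Measure (S → Spin))]
        fun ω => (specification U Λ ω : Measure (S → Spin)).real A

/-! ### The standard Ising model on the half-line -/

/-- The Hamiltonian of the standard Ising model on `[0, N]`, free on the left and with boundary
spin `s` on the right, which is coupled to the last spin with strength `c`. -/
def isingHamiltonian (β J h c : ℝ) (N : ℕ) (s : Spin) (σ : ℕ → Spin) : ℝ :=
  -β * (∑ i ∈ Finset.range N, J * sv (σ i) * sv (σ (i + 1))
    + ∑ i ∈ Finset.range (N + 1), h * sv (σ i)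
    + c * sv (σ N) * sv s)

/-- The finite-volume standard Ising measure on `[0, N]` (with the spin `s` at all sites
beyond `N`). -/
def isingMeasure (β J h c : ℝ) (N : ℕ) (s : Spin) : ProbabilityMeasure (ℕ → Spin) :=
  finiteVolume (Finset.range (N + 1)) (isingHamiltonian β J h c N s) fun _ => s

/-! ### The multiplicative Ising model -/

/-- The multiplicative Ising Hamiltonian on `[1, 2N]` with boundary condition `η`, where the
boundary spins are coupled with strength `c`. It depends on `σ` only through the spins in
`[1, 2N]`. -/
def mulHamiltonian (β J h c : ℝ) (N : ℕ+) (η σ : ℕ+ → Spin) : ℝ :=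
  -β * (∑ i ∈ Finset.Icc 1 N, J * sv (σ i) * sv (σ (2 * i))
    + ∑ i ∈ Finset.Icc 1 (2 * N), h * sv (σ i)
    + ∑ i ∈ Finset.Icc (N + 1) (2 * N), c * sv (σ i) * sv (η (2 * i)))

/-- The finite-volume measure `μ_N^η` on `[1, 2N]` (with the configuration `η` off `[1, 2N]`). -/
def mulMeasure (β J h c : ℝ) (N : ℕ+) (η : ℕ+ → Spin) : ProbabilityMeasure (ℕ+ → Spin) :=
  finiteVolume (Finset.Icc 1 (2 * N)) (mulHamiltonian β J h c N η) η

open Classical in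
/-- The potential `U({i}, σ) = -β h σ_i`, `U({i, 2i}, σ) = -β J σ_i σ_{2i}`, and `U(A, σ) = 0`
for all other `A`. -/
def mulPotential (β J h : ℝ) (A : Finset ℕ+) (σ : ℕ+ → Spin) : ℝ :=
  if ∃ i : ℕ+, A = {i} then -β * h * ∏ j ∈ A, sv (σ j)
  else if ∃ i : ℕ+, A = {i, 2 * i} then -β * J * ∏ j ∈ A, sv (σ j)
  else 0

/-- The layer spins `τ^r_i = σ_{r 2^i}`. -/
def layer (r : ℕ+) (σ : ℕ+ → Spin) : ℕ → Spin := fun i => σ (r * 2 ^ i)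

/-- The multiplicative shift `(T_i σ)_j = σ_{i j}`. -/
def mulShift (i : ℕ+) (σ : ℕ+ → Spin) : ℕ+ → Spin := fun j => σ (i * j)

end MulIsing

end

/-!
Without a magnetic field the Ising model on a forest is solved by passing from the spins to the
bond variables `σ_i σ_j` along the edges. The graph with edges `{i, 2i}` on the positive integers
is a disjoint union of half-lines, the layers `{r 2^k}` with `r` odd. Put `K = βJ`. The limit
`mulLimit K` is the law of the configuration whose spins at odd sites are uniform and whose bond
variables have mean `tanh K`, all of them independent; `isingLimit K` is the same construction on a
single half-line. Hence the layers are independent copies of `isingLimit K`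
(`map_layers_mulLimit`). The chain `isingLimit K` is stationary
(`measurePreserving_shift_isingLimit`), and if `i = m 2^a` with `m` odd, then layer `r` of `T_i σ`
is layer `m r` of `σ` shifted by `a`, which gives the invariance (`measurePreserving_mulShift`).

*Convergence.* The marginal of `mulLimit K` on `[1, 2N]` is the free Boltzmann measure
(`mulLimit_real_cyl`), so a finite-volume measure with boundary spins has with respect to it the
density `∏ (1 + tanh(βc) η_{2i} σ_i)` over `N < i ≤ 2N`, one factor for the last site of each layer
(`finiteVolume_real_cyl_of_density`). By independence of the layers, a cylinder probability is a
finite product over the layers that the cylinder meets. In each factor the boundary contributes a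
correlation between the cylinder and a spin far out in the layer; it decays like `|tanh K| ^ n`
(`integral_mul_sv_succ`), and `|tanh K| < 1`. The half-line model is the case of one layer.

*Gibbs measures.* The specification on `[1, 2N]` is the finite-volume measure with `c = J`
(`specification_Icc`), so the cylinder probabilities of a Gibbs measure are averages of quantities
that converge to those of `mulLimit K`; this gives uniqueness (`IsGibbs.eq_mulLimit`). Conversely,
`mulLimit K` is quasi-invariant under flips of finitely many spins, with the Boltzmann factor of the
energy change as density (`map_mul_mulLimit`). Writing the sum over `{-1, 1}^Λ` in the specification
as a sum over flips turns this into the conditional probabilities (`isGibbs_mulLimit`).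
-/

noncomputable section

namespace MulIsing

/-! ### Cylinders -/

section Cylinders

variable {S : Type*}

/-- The cylinder of the configurations that agree with `ξ` on the finite set `D`. -/
def cyl (D : Finset S) (ξ : S → Spin) : Set (S → Spin) := {σ | ∀ x ∈ D, σ x = ξ x}

theorem cyl_eq_pi (D : Finset S) (ξ : S → Spin) : cyl D ξ = Set.pi D fun x => {ξ x} := by
  ext σ
  simp [cyl]

theorem measurableSet_cyl (D : Finset S) (ξ : S → Spin) : MeasurableSet (cyl D ξ) := by
  rw [cyl_eq_pi]
  exact MeasurableSet.pi D.countable_toSet fun _ _ => MeasurableSet.of_discrete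

theorem isOpen_cyl (D : Finset S) (ξ : S → Spin) : IsOpen (cyl D ξ) := by
  rw [cyl_eq_pi]
  exact isOpen_set_pi D.finite_toSet fun _ _ => isOpen_discrete _

theorem dependsOn_indicator_cyl (D : Finset S) (ξ : S → Spin) :
    DependsOn ((cyl D ξ).indicator fun _ => (1 : ℝ)) D := by
  classical
  intro σ τ h
  have : σ ∈ cyl D ξ ↔ τ ∈ cyl D ξ :=
    forall₂_congr fun x hx => by rw [h x (Finset.mem_coe.2 hx)]
  simp only [Set.indicator_apply, this]

theorem isPiSystem_cyl : IsPiSystem {s | ∃ (D : Finset S) (ξ : S → Spin), s = cyl D ξ} := by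
  classical
  rintro _ ⟨D, ξ, rfl⟩ _ ⟨E, η, rfl⟩ ⟨σ, hD, hE⟩
  refine ⟨D ∪ E, σ, ?_⟩
  ext τ
  constructor
  · rintro ⟨h₁, h₂⟩ x hx
    rcases Finset.mem_union.1 hx with hx | hx
    · rw [h₁ x hx, hD x hx]
    · rw [h₂ x hx, hE x hx]
  · intro h
    exact ⟨fun x hx => by rw [h x (Finset.mem_union_left _ hx), hD x hx],
      fun x hx => by rw [h x (Finset.mem_union_right _ hx), hE x hx]⟩

/-- Probability measures converge weakly as soon as the probabilities of cylinders do. -/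
theorem tendsto_of_tendsto_cyl [Countable S] {ι : Type*} {l : Filter ι} [l.IsCountablyGenerated]
    {μ : ι → ProbabilityMeasure (S → Spin)} {ν : ProbabilityMeasure (S → Spin)}
    (h : ∀ (D : Finset S) (ξ : S → Spin),
      Tendsto (fun i => (μ i : Measure (S → Spin)).real (cyl D ξ)) l
        (𝓝 ((ν : Measure (S → Spin)).real (cyl D ξ)))) :
    Tendsto μ l (𝓝 ν) := by
  refine isPiSystem_cyl.tendsto_probabilityMeasure_of_tendsto_of_mem ?_ ?_ ?_
  · rintro _ ⟨D, ξ, rfl⟩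
    exact measurableSet_cyl D ξ
  · intro u hu x hx
    obtain ⟨D, v, hv, hvu⟩ := isOpen_pi_iff.1 hu x hx
    refine ⟨cyl D x, ⟨D, x, rfl⟩, (isOpen_cyl D x).mem_nhds fun _ _ => rfl, fun σ hσ => ?_⟩
    refine hvu fun i hi => ?_
    rw [hσ i hi]
    exact (hv i hi).2
  · rintro _ ⟨D, ξ, rfl⟩
    rw [← NNReal.tendsto_coe]
    exact h D ξ

variable [DecidableEq S]

theorem restrict_preimage_singleton (Λ : Finset S) (ω : S → Spin) (ζ : Λ → Spin) :
    (Λ.restrict : (S → Spin) → Λ → Spin) ⁻¹' {ζ} = cyl Λ (glue Λ ω ζ) := by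
  ext σ
  simp only [Set.mem_preimage, Set.mem_singleton_iff, funext_iff, Finset.restrict, Subtype.forall]
  exact forall₂_congr fun x hx => by simp [glue, hx]

/-- Finite measures agree if they agree on the cylinders over arbitrarily large finite sets. -/
theorem ext_of_cyl {μ ν : Measure (S → Spin)} [IsFiniteMeasure μ] [IsFiniteMeasure ν]
    (h : ∀ D : Finset S, ∃ Λ, D ⊆ Λ ∧ ∀ ξ, μ.real (cyl Λ ξ) = ν.real (cyl Λ ξ)) : μ = ν := by
  refine IsProjectiveLimit.unique (P := fun I : Finset S => ν.map I.restrict)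
    (fun D => ?_) fun D => rfl
  obtain ⟨Λ, hD, hΛ⟩ := h D
  have key : μ.map Λ.restrict = ν.map Λ.restrict := by
    refine Measure.ext_of_singleton fun ζ => ?_
    rw [Measure.map_apply (by fun_prop) (measurableSet_singleton _),
      Measure.map_apply (by fun_prop) (measurableSet_singleton _),
      restrict_preimage_singleton Λ 1 ζ]
    exact (ENNReal.toReal_eq_toReal_iff' (measure_ne_top _ _) (measure_ne_top _ _)).1 (hΛ _)
  have hc : D.restrict (π := fun _ => Spin) = Finset.restrict₂ hD ∘ Λ.restrict := rfl
  rw [hc, ← Measure.map_map (by fun_prop) (by fun_prop), key,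
    Measure.map_map (by fun_prop) (by fun_prop), ← hc]

/-- The integral of a function of the spins in `Λ` is a finite sum over `{-1, 1}^Λ`. -/
theorem integral_eq_sum_cyl (μ : Measure (S → Spin)) [IsFiniteMeasure μ] (Λ : Finset S)
    {F : (S → Spin) → ℝ} (hF : DependsOn F Λ) (ω : S → Spin) :
    ∫ σ, F σ ∂μ = ∑ ζ : Λ → Spin, μ.real (cyl Λ (glue Λ ω ζ)) * F (glue Λ ω ζ) := by
  have h1 : ∀ σ, F σ = F (glue Λ ω (Λ.restrict σ)) := fun σ => hF fun x hx => by
    simp [glue, Finset.mem_coe.1 hx]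
  calc ∫ σ, F σ ∂μ = ∫ σ, (fun ζ => F (glue Λ ω ζ)) (Λ.restrict σ) ∂μ :=
        integral_congr_ae (ae_of_all _ h1)
    _ = ∫ ζ, F (glue Λ ω ζ) ∂(μ.map Λ.restrict) :=
        (integral_map (f := fun ζ => F (glue Λ ω ζ)) (by fun_prop)
          Measurable.of_discrete.aestronglyMeasurable).symm
    _ = _ := by
      rw [integral_fintype .of_finite]
      refine Finset.sum_congr rfl fun ζ _ => ?_
      rw [map_measureReal_apply (by fun_prop) (measurableSet_singleton _),
        restrict_preimage_singleton Λ ω ζ, smul_eq_mul]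

theorem eq_comp_restrict_of_dependsOn {Λ : Finset S} {F : (S → Spin) → ℝ} (hF : DependsOn F Λ) :
    F = (fun ζ => F (glue Λ 1 ζ)) ∘ Λ.restrict :=
  funext fun σ => hF fun x hx => by simp [glue, Finset.mem_coe.1 hx]

theorem measurable_of_dependsOn {Λ : Finset S} {F : (S → Spin) → ℝ} (hF : DependsOn F Λ) :
    Measurable F := by
  rw [eq_comp_restrict_of_dependsOn hF]
  exact Measurable.of_discrete.comp (by fun_prop)

/-- The probability of an event under a finite-volume measure, as a quotient of finite sums. -/
theorem finiteVolume_real (Λ : Finset S) (H : (S → Spin) → ℝ) (ω : S → Spin)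
    {A : Set (S → Spin)} (hA : MeasurableSet A) :
    (finiteVolume Λ H ω : Measure (S → Spin)).real A
      = (∑ ζ, Real.exp (-H (glue Λ ω ζ)) * A.indicator (fun _ => 1) (glue Λ ω ζ))
        / ∑ ζ, Real.exp (-H (glue Λ ω ζ)) := by
  have hZ : 0 ≤ ∑ ζ, Real.exp (-H (glue Λ ω ζ)) :=
    Finset.sum_nonneg fun _ _ => (Real.exp_pos _).le
  change ((boltzmann fun ζ : Λ → Spin => H (glue Λ ω ζ)).map (glue Λ ω)).real A = _
  rw [map_measureReal_apply (measurable_glue Λ ω) hA, measureReal_def, boltzmann]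
  simp only [Measure.coe_finsetSum, Finset.sum_apply, Measure.smul_apply, smul_eq_mul]
  rw [ENNReal.toReal_sum fun ζ _ => ENNReal.mul_ne_top ENNReal.ofReal_ne_top (measure_ne_top _ _),
    Finset.sum_div]
  refine Finset.sum_congr rfl fun ζ _ => ?_
  rw [ENNReal.toReal_mul, ENNReal.toReal_ofReal (div_nonneg (Real.exp_pos _).le hZ),
    Measure.dirac_apply' _ (measurable_glue Λ ω hA)]
  by_cases h : glue Λ ω ζ ∈ A <;> simp [Set.indicator, h]

theorem finiteVolume_congr {Λ : Finset S} {H H' : (S → Spin) → ℝ} {ω : S → Spin}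
    (h : ∀ ζ, H (glue Λ ω ζ) = H' (glue Λ ω ζ)) :
    finiteVolume Λ H ω = finiteVolume Λ H' ω := by
  simp only [finiteVolume, h]
  rfl

/-- If the Boltzmann weights of a finite-volume measure are, up to a constant, those of the
marginal of `μ` times a density `G`, then events have probabilities `∫ 1_A G dμ / ∫ G dμ`. -/
theorem finiteVolume_real_cyl_of_density (μ : Measure (S → Spin)) [IsFiniteMeasure μ]
    {Λ D : Finset S} (hD : D ⊆ Λ) {H G : (S → Spin) → ℝ} (hG : DependsOn G Λ) (ω : S → Spin)
    {C : ℝ} (hC : C ≠ 0)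
    (h : ∀ ζ, Real.exp (-H (glue Λ ω ζ))
      = C * (μ.real (cyl Λ (glue Λ ω ζ)) * G (glue Λ ω ζ))) (ξ : S → Spin) :
    (finiteVolume Λ H ω : Measure (S → Spin)).real (cyl D ξ)
      = (∫ σ, (cyl D ξ).indicator (fun _ => 1) σ * G σ ∂μ) / ∫ σ, G σ ∂μ := by
  have hF : DependsOn (fun σ => (cyl D ξ).indicator (fun _ => (1 : ℝ)) σ * G σ) Λ := by
    intro σ τ hστ
    simp only [hG hστ, dependsOn_indicator_cyl D ξ fun x hx => hστ x (hD hx)]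
  rw [finiteVolume_real _ _ _ (measurableSet_cyl D ξ), integral_eq_sum_cyl μ Λ hG ω,
    integral_eq_sum_cyl μ Λ hF ω]
  simp only [h]
  rw [← Finset.mul_sum, ← mul_div_mul_left _ (∑ ζ : Λ → Spin, μ.real _ * _) hC]
  congr 1
  rw [Finset.mul_sum]
  exact Finset.sum_congr rfl fun ζ _ => by ring

end Cylinders

/-! ### Spins and bond variables -/

theorem sv_mul (s t : Spin) : sv (s * t) = sv s * sv t := by simp [sv]

theorem abs_sv (s : Spin) : |sv s| = 1 := by
  rcases Int.units_eq_one_or s with rfl | rfl <;> simp [sv]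

/-- The high-temperature expansion of a Boltzmann factor. -/
theorem exp_mul_sv (K : ℝ) (s : Spin) :
    Real.exp (K * sv s) = Real.cosh K * (1 + Real.tanh K * sv s) := by
  have hc : Real.cosh K ≠ 0 := (Real.cosh_pos K).ne'
  rw [Real.tanh_eq_sinh_div_cosh]
  rcases Int.units_eq_one_or s with rfl | rfl
  · simp only [sv, Units.val_one, Int.cast_one, mul_one]
    rw [mul_add, mul_div_cancel₀ _ hc, mul_one, Real.cosh_add_sinh]
  · simp only [sv, Units.val_neg, Units.val_one, Int.cast_neg, Int.cast_one, mul_neg, mul_one]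
    rw [mul_add, mul_neg, mul_div_cancel₀ _ hc, mul_one, ← sub_eq_add_neg, Real.cosh_sub_sinh]

/-- The law of a spin in the field `K`; it is also the law of a bond variable `σ_i σ_j` for the
coupling `K`. The field `0` gives the uniform distribution. -/
def bondLaw (K : ℝ) : Measure Spin := boltzmann fun s => -(K * sv s)

instance (K : ℝ) : IsProbabilityMeasure (bondLaw K) := isProbabilityMeasure_boltzmann _

theorem bondLaw_real_singleton (K : ℝ) (s : Spin) :
    (bondLaw K).real {s} = (2 * Real.cosh K)⁻¹ * Real.exp (K * sv s) := by
  have hZ : ∑ s, Real.exp (K * sv s) = 2 * Real.cosh K := by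
    simp only [exp_mul_sv, UnitsInt.univ]
    simp [sv]
    ring
  rw [measureReal_def, bondLaw, boltzmann]
  simp only [Measure.coe_finsetSum, Finset.sum_apply, Measure.smul_apply, smul_eq_mul, neg_neg, hZ]
  rw [Finset.sum_eq_single s]
  · rw [Measure.dirac_apply_of_mem (Set.mem_singleton s), mul_one,
      ENNReal.toReal_ofReal (by positivity), div_eq_inv_mul]
  · intro t _ hts
    rw [Measure.dirac_apply, Set.indicator_of_notMem (by simpa using hts), mul_zero]
  · exact fun h => absurd (Finset.mem_univ s) h

theorem integral_sv_bondLaw (K : ℝ) : ∫ s, sv s ∂(bondLaw K) = Real.tanh K := by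
  have hc : Real.cosh K ≠ 0 := (Real.cosh_pos K).ne'
  rw [integral_fintype .of_finite]
  simp only [bondLaw_real_singleton, exp_mul_sv, UnitsInt.univ, smul_eq_mul]
  simp [sv]
  field_simp
  ring

section Bonds

variable {S : Type*}

/-- If the spins are built from independent bond variables in such a way that the spins in `Λ`
correspond to the bond variables indexed by `Λ`, then cylinder probabilities are Boltzmann
weights. -/
theorem map_bonds_real_cyl (k : S → ℝ) {Φ : (S → Spin) → S → Spin} (hΦ : Measurable Φ)
    {Λ : Finset S} {ξ d : S → Spin} (h : ∀ b, Φ b ∈ cyl Λ ξ ↔ b ∈ cyl Λ d) :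
    ((Measure.infinitePi fun x => bondLaw (k x)).map Φ).real (cyl Λ ξ)
      = (∏ x ∈ Λ, (2 * Real.cosh (k x))⁻¹) * Real.exp (∑ x ∈ Λ, k x * sv (d x)) := by
  have : Φ ⁻¹' cyl Λ ξ = cyl Λ d := Set.ext h
  rw [map_measureReal_apply hΦ (measurableSet_cyl _ _), this, cyl_eq_pi, measureReal_def,
    Measure.infinitePi_pi _ fun _ _ => MeasurableSet.of_discrete, ENNReal.toReal_prod,
    Real.exp_sum, ← Finset.prod_mul_distrib]
  exact Finset.prod_congr rfl fun x _ => bondLaw_real_singleton _ _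

/-- Independence of one coordinate from finitely many others under a product measure. -/
theorem integral_mul_infinitePi [DecidableEq S] (P : S → Measure Spin)
    [∀ x, IsProbabilityMeasure (P x)] {D : Finset S} {x : S} (hx : x ∉ D)
    {g : (S → Spin) → ℝ} (hg : DependsOn g D) (f : Spin → ℝ) :
    ∫ b, g b * f (b x) ∂(Measure.infinitePi P)
      = (∫ b, g b ∂(Measure.infinitePi P)) * ∫ s, f s ∂(P x) := by
  have hind : iIndepFun (fun (y : S) (b : S → Spin) => b y) (Measure.infinitePi P) :=
    iIndepFun_infinitePi (X := fun _ s => s) fun _ => measurable_id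
  have h1 := (hind.indepFun_finset D {x} (Finset.disjoint_singleton_right.2 hx)
    fun y => measurable_pi_apply y).comp (φ := fun u => g (glue D 1 u))
    (ψ := fun v => f (v ⟨x, Finset.mem_singleton_self x⟩)) .of_discrete .of_discrete
  have hg' : (fun u => g (glue D 1 u)) ∘ (fun (b : S → Spin) (i : D) => b i) = g :=
    funext fun b => hg fun y hy => by simp [glue, Finset.mem_coe.1 hy]
  rw [hg'] at h1
  have h2 := h1.integral_fun_mul_eq_mul_integral
    (measurable_of_dependsOn hg).aestronglyMeasurable
    (Measurable.aestronglyMeasurable (by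
      have hf : Measurable f := .of_discrete
      exact hf.comp (measurable_pi_apply x)))
  refine h2.trans ?_
  congr 1
  change ∫ b, f (b x) ∂(Measure.infinitePi P) = _
  rw [← integral_map (φ := fun b : S → Spin => b x) (measurable_pi_apply x).aemeasurable
    (Measurable.of_discrete (f := f)).aestronglyMeasurable]
  rw [show (fun b : S → Spin => b x) = Function.eval x from rfl, Measure.infinitePi_map_eval]

end Bonds

/-! ### The half-line Ising chain -/

/-- The spins of a chain with bond variables `b`: the first one is `b 0`, and the ratio of two
neighbours is the bond variable of the second. -/
def cumProd (b : ℕ → Spin) : ℕ → Spin := fun n => ∏ k ∈ Finset.range (n + 1), b k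

theorem cumProd_zero (b : ℕ → Spin) : cumProd b 0 = b 0 := by simp [cumProd]

theorem cumProd_succ (b : ℕ → Spin) (n : ℕ) : cumProd b (n + 1) = cumProd b n * b (n + 1) :=
  Finset.prod_range_succ _ _

theorem measurable_cumProd : Measurable cumProd :=
  measurable_pi_lambda _ fun _ => Finset.measurable_fun_prod _ fun i _ => measurable_pi_apply i

/-- The half-line Ising measure without field for the coupling `K`: the first spin is uniform and
the bond variables are independent. -/
def isingLimit (K : ℝ) : ProbabilityMeasure (ℕ → Spin) :=
  ⟨(Measure.infinitePi fun n : ℕ => bondLaw (if n = 0 then 0 else K)).map cumProd,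
    Measure.isProbabilityMeasure_map measurable_cumProd.aemeasurable⟩

/-- The marginal of the half-line measure on `[0, N]` is the free Boltzmann measure. -/
theorem isingLimit_real_cyl (K : ℝ) (N : ℕ) (ξ : ℕ → Spin) :
    (isingLimit K : Measure (ℕ → Spin)).real (cyl (Finset.range (N + 1)) ξ)
      = (2 * Real.cosh K)⁻¹ ^ N * 2⁻¹
        * Real.exp (K * ∑ i ∈ Finset.range N, sv (ξ i) * sv (ξ (i + 1))) := by
  have h : ∀ b, cumProd b ∈ cyl (Finset.range (N + 1)) ξ ↔
      b ∈ cyl (Finset.range (N + 1)) fun n => Nat.casesOn n (ξ 0) fun m => ξ m * ξ (m + 1) := by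
    intro b
    simp only [cyl, Set.mem_ofPred_eq, Finset.mem_range]
    constructor
    · rintro h (_ | n) hn
      · exact (cumProd_zero b).symm.trans (h 0 hn)
      · change _ = ξ n * ξ (n + 1)
        rw [← h (n + 1) hn, ← h n (by omega), cumProd_succ, ← mul_assoc, Int.units_mul_self,
          one_mul]
    · intro h n hn
      induction n with
      | zero => exact (cumProd_zero b).trans (h 0 hn)
      | succ n ih =>
        rw [cumProd_succ, ih (by omega), h (n + 1) hn, ← mul_assoc, Int.units_mul_self, one_mul]
  refine (map_bonds_real_cyl _ measurable_cumProd h).trans ?_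
  rw [Finset.sum_range_succ', Finset.prod_range_succ']
  simp [sv_mul, Finset.mul_sum]

/-- A chain forgets: each further bond multiplies the correlation of the last spin with the
initial segment by `tanh K`. -/
theorem integral_mul_sv_succ (K : ℝ) {n : ℕ} {f : (ℕ → Spin) → ℝ}
    (hf : DependsOn f (Finset.range (n + 1))) :
    ∫ σ, f σ * sv (σ (n + 1)) ∂(isingLimit K : Measure (ℕ → Spin))
      = Real.tanh K * ∫ σ, f σ * sv (σ n) ∂(isingLimit K : Measure (ℕ → Spin)) := by
  have hsv : Measurable sv := .of_discrete
  have hm := measurable_of_dependsOn hf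
  have key : ∀ m, ∫ σ, f σ * sv (σ m) ∂(isingLimit K : Measure (ℕ → Spin))
      = ∫ b, f (cumProd b) * sv (cumProd b m)
        ∂(Measure.infinitePi fun n : ℕ => bondLaw (if n = 0 then 0 else K)) := fun m =>
    integral_map measurable_cumProd.aemeasurable
      (hm.mul (hsv.comp (measurable_pi_apply m))).aestronglyMeasurable
  have hcum : ∀ {b b' : ℕ → Spin}, (∀ i ∈ (Finset.range (n + 1) : Set ℕ), b i = b' i) →
      ∀ i ∈ (Finset.range (n + 1) : Set ℕ), cumProd b i = cumProd b' i := by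
    intro b b' h i hi
    simp only [Finset.coe_range, Set.mem_Iio] at h hi
    exact Finset.prod_congr rfl fun k hk => h k (by have := Finset.mem_range.1 hk; omega)
  have hdep : DependsOn (fun b : ℕ → Spin => f (cumProd b) * sv (cumProd b n))
      (Finset.range (n + 1)) := by
    intro b b' h
    change f (cumProd b) * sv (cumProd b n) = f (cumProd b') * sv (cumProd b' n)
    rw [hf (hcum h), hcum h n (by simp)]
  rw [key, key, mul_comm (Real.tanh K)]
  refine Eq.trans ?_ ((integral_mul_infinitePi (fun n : ℕ => bondLaw (if n = 0 then 0 else K))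
    (x := n + 1) (by simp) hdep sv).trans ?_)
  · simp only [cumProd_succ, sv_mul, mul_assoc]
  · rw [integral_sv_bondLaw, if_neg (Nat.succ_ne_zero n)]

theorem integral_sv_isingLimit (K : ℝ) (n : ℕ) :
    ∫ σ, sv (σ n) ∂(isingLimit K : Measure (ℕ → Spin)) = 0 := by
  have hsv : Measurable sv := .of_discrete
  induction n with
  | zero =>
    refine (integral_map measurable_cumProd.aemeasurable
      (hsv.comp (measurable_pi_apply 0)).aestronglyMeasurable).trans ?_
    change ∫ b, sv (cumProd b 0) ∂_ = 0
    simp only [cumProd_zero]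
    have := integral_mul_infinitePi (fun n : ℕ => bondLaw (if n = 0 then 0 else K))
      (x := 0) (D := ∅) (by simp) (g := fun _ => 1) (fun _ _ _ => rfl) sv
    simpa [integral_sv_bondLaw] using this
  | succ n ih =>
    simpa [ih] using integral_mul_sv_succ K (n := n) (f := fun _ => 1) fun _ _ _ => rfl

theorem abs_tanh_lt_one (x : ℝ) : |Real.tanh x| < 1 :=
  abs_lt.2 ⟨Real.neg_one_lt_tanh x, Real.tanh_lt_one x⟩

/-- The spin at `n` is asymptotically uncorrelated with every event on an initial segment. -/
theorem tendsto_integral_cyl_mul_sv (K : ℝ) (D : Finset ℕ) (ξ : ℕ → Spin) :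
    Tendsto (fun n => ∫ σ, (cyl D ξ).indicator (fun _ => 1) σ * sv (σ n)
      ∂(isingLimit K : Measure (ℕ → Spin))) atTop (𝓝 0) := by
  obtain ⟨m, hm⟩ : ∃ m, D ⊆ Finset.range (m + 1) :=
    ⟨D.sup id, fun x hx => Finset.mem_range.2 (Nat.lt_succ_of_le (Finset.le_sup (f := id) hx))⟩
  rw [← tendsto_add_atTop_iff_nat m]
  set a := ∫ σ, (cyl D ξ).indicator (fun _ => 1) σ * sv (σ m) ∂(isingLimit K : Measure (ℕ → Spin))
  have h : ∀ n, ∫ σ, (cyl D ξ).indicator (fun _ => 1) σ * sv (σ (n + m))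
      ∂(isingLimit K : Measure (ℕ → Spin)) = Real.tanh K ^ n * a := by
    intro n
    induction n with
    | zero => simp [a]
    | succ n ih =>
      rw [add_right_comm, integral_mul_sv_succ, ih, pow_succ, mul_left_comm, mul_assoc,
        mul_left_comm]
      refine (dependsOn_indicator_cyl D ξ).mono ?_
      exact_mod_cast hm.trans (Finset.range_mono (by omega))
  simp only [h]
  simpa using (tendsto_pow_atTop_nhds_zero_of_abs_lt_one (abs_tanh_lt_one K)).mul_const a

theorem integrable_cyl_mul_sv (μ : Measure (ℕ → Spin)) [IsFiniteMeasure μ] (D : Finset ℕ)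
    (ξ : ℕ → Spin) (n : ℕ) :
    Integrable (fun σ => (cyl D ξ).indicator (fun _ => 1) σ * sv (σ n)) μ := by
  have hsv : Measurable sv := .of_discrete
  refine Integrable.of_bound (C := 1) (Measurable.aestronglyMeasurable ?_) (ae_of_all _ fun σ => ?_)
  · exact (measurable_const.indicator (measurableSet_cyl D ξ)).mul
      (hsv.comp (measurable_pi_apply n))
  · rw [norm_mul, Real.norm_eq_abs (sv _), abs_sv, mul_one]
    by_cases h : σ ∈ cyl D ξ <;> simp [h]

/-- Cylinder probabilities after tilting the half-line measure by a field on one spin. -/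
theorem integral_cyl_mul_one_add (K : ℝ) (D : Finset ℕ) (ξ : ℕ → Spin) (a : ℝ) (n : ℕ) :
    ∫ σ, (cyl D ξ).indicator (fun _ => 1) σ * (1 + a * sv (σ n))
        ∂(isingLimit K : Measure (ℕ → Spin))
      = (isingLimit K : Measure (ℕ → Spin)).real (cyl D ξ)
        + a * ∫ σ, (cyl D ξ).indicator (fun _ => 1) σ * sv (σ n)
          ∂(isingLimit K : Measure (ℕ → Spin)) := by
  have h1 : Integrable ((cyl D ξ).indicator fun _ => (1 : ℝ))
      (isingLimit K : Measure (ℕ → Spin)) :=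
    (integrable_const _).indicator (measurableSet_cyl D ξ)
  rw [← integral_const_mul, ← integral_indicator_one (measurableSet_cyl D ξ)]
  change _ = ∫ σ, (cyl D ξ).indicator (fun _ => (1 : ℝ)) σ ∂_ + _
  refine Eq.trans ?_ (integral_add h1 ((integrable_cyl_mul_sv _ D ξ n).const_mul a))
  congr 1 with σ
  ring

theorem isingHamiltonian_weight (β J c : ℝ) (N : ℕ) (s : Spin) (σ : ℕ → Spin) :
    Real.exp (-isingHamiltonian β J 0 c N s σ)
      = Real.exp (β * J * ∑ i ∈ Finset.range N, sv (σ i) * sv (σ (i + 1)))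
        * (Real.cosh (β * c) * (1 + Real.tanh (β * c) * sv s * sv (σ N))) := by
  rw [mul_assoc _ (sv s), ← sv_mul, ← exp_mul_sv, ← Real.exp_add, sv_mul]
  congr 1
  simp only [isingHamiltonian, mul_assoc, ← Finset.mul_sum]
  ring

theorem isingMeasure_real_cyl (β J c : ℝ) {N : ℕ} (s : Spin) {D : Finset ℕ}
    (hD : D ⊆ Finset.range (N + 1)) (ξ : ℕ → Spin) :
    (isingMeasure β J 0 c N s : Measure (ℕ → Spin)).real (cyl D ξ)
      = (isingLimit (β * J) : Measure (ℕ → Spin)).real (cyl D ξ)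
        + Real.tanh (β * c) * sv s * ∫ σ, (cyl D ξ).indicator (fun _ => 1) σ * sv (σ N)
          ∂(isingLimit (β * J) : Measure (ℕ → Spin)) := by
  refine (finiteVolume_real_cyl_of_density (isingLimit (β * J) : Measure (ℕ → Spin)) hD
    (G := fun σ => 1 + Real.tanh (β * c) * sv s * sv (σ N)) (fun σ τ h => ?_) _
    (C := (2 * Real.cosh (β * J)) ^ N * 2 * Real.cosh (β * c)) (by positivity)
    (fun ζ => ?_) ξ).trans ?_
  · simp only [h N (by simp)]
  · have hJ : Real.cosh (β * J) ≠ 0 := (Real.cosh_pos _).ne'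
    rw [isingHamiltonian_weight, isingLimit_real_cyl, inv_pow]
    field_simp
  · -- the density has integral `1`, since spins have mean zero
    have hone := integral_cyl_mul_one_add (β * J) ∅ 1 (Real.tanh (β * c) * sv s) N
    have huniv : cyl (∅ : Finset ℕ) (1 : ℕ → Spin) = Set.univ := by ext; simp [cyl]
    simp only [huniv, Set.indicator_univ, one_mul, integral_sv_isingLimit, mul_zero, add_zero,
      probReal_univ] at hone
    rw [hone, div_one, integral_cyl_mul_one_add]

theorem tendsto_isingMeasure (β J c : ℝ) (s : Spin) :
    Tendsto (fun N : ℕ => isingMeasure β J 0 c N s) atTop (𝓝 (isingLimit (β * J))) := by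
  refine tendsto_of_tendsto_cyl fun D ξ => ?_
  have h := ((tendsto_integral_cyl_mul_sv (β * J) D ξ).const_mul
    (Real.tanh (β * c) * sv s)).const_add
      ((isingLimit (β * J) : Measure (ℕ → Spin)).real (cyl D ξ))
  rw [mul_zero, add_zero] at h
  refine h.congr' ?_
  filter_upwards [eventually_ge_atTop (D.sup id)] with N hN
  refine (isingMeasure_real_cyl β J c s (fun x hx => ?_) ξ).symm
  exact Finset.mem_range.2 (Nat.lt_succ_of_le ((Finset.le_sup (f := id) hx).trans hN))

/-! ### Layers -/

/-- The odd positive integers, which index the layers. -/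
abbrev OddPNat : Type := {r : ℕ+ // Odd (r : ℕ)}

theorem bijective_mul_two_pow :
    Function.Bijective fun p : OddPNat × ℕ => (p.1 : ℕ+) * 2 ^ p.2 := by
  constructor
  · rintro ⟨⟨r, hr⟩, k⟩ ⟨⟨r', hr'⟩, k'⟩ h
    have h' : (r : ℕ) * 2 ^ k = r' * 2 ^ k' := by
      have := congrArg PNat.val h
      simpa using this
    have hk : k = k' := by
      wlog hlt : k < k' generalizing r r' k k'
      · rcases (not_lt.1 hlt).eq_or_lt with h1 | h1
        · exact h1.symm
        · exact (this k' r' hr' k r hr h.symm h'.symm h1).symm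
      exfalso
      obtain ⟨d, rfl⟩ := Nat.exists_eq_add_of_lt hlt
      rw [show k + d + 1 = k + (d + 1) by ring, pow_add, mul_comm (2 ^ k), ← mul_assoc] at h'
      have h2 := Nat.eq_of_mul_eq_mul_right (by positivity) h'
      rw [h2, pow_succ, ← mul_assoc] at hr
      exact Nat.not_even_iff_odd.2 hr (by simp)
    subst hk
    have : r = r' := PNat.eq (Nat.eq_of_mul_eq_mul_right (by positivity) h')
    simp [this]
  · intro x
    obtain ⟨k, m, hm, hx⟩ := Nat.exists_eq_two_pow_mul_odd x.ne_zero
    refine ⟨⟨⟨⟨m, hm.pos⟩, hm⟩, k⟩, PNat.eq ?_⟩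
    change m * 2 ^ k = (x : ℕ)
    rw [hx, mul_comm]

/-- Every positive integer is `r 2 ^ k` for a unique odd `r` and a unique `k`. -/
def siteEquiv : OddPNat × ℕ ≃ ℕ+ := Equiv.ofBijective _ bijective_mul_two_pow

/-- The odd part of a positive integer, i.e. the layer to which it belongs. -/
def oddPart (x : ℕ+) : OddPNat := (siteEquiv.symm x).1

/-- The exponent of `2` in a positive integer, i.e. its position in its layer. -/
def twoVal (x : ℕ+) : ℕ := (siteEquiv.symm x).2

theorem oddPart_mul_two_pow_twoVal (x : ℕ+) : (oddPart x : ℕ+) * 2 ^ twoVal x = x :=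
  siteEquiv.apply_symm_apply x

theorem siteEquiv_symm_mul_two_pow (r : OddPNat) (k : ℕ) :
    siteEquiv.symm ((r : ℕ+) * 2 ^ k) = (r, k) :=
  siteEquiv.symm_apply_apply (r, k)

theorem oddPart_mul_two_pow (r : OddPNat) (k : ℕ) : oddPart ((r : ℕ+) * 2 ^ k) = r :=
  congrArg Prod.fst (siteEquiv_symm_mul_two_pow r k)

theorem twoVal_mul_two_pow (r : OddPNat) (k : ℕ) : twoVal ((r : ℕ+) * 2 ^ k) = k :=
  congrArg Prod.snd (siteEquiv_symm_mul_two_pow r k)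

theorem layer_oddPart_twoVal (σ : ℕ+ → Spin) (x : ℕ+) : layer (oddPart x) σ (twoVal x) = σ x := by
  rw [layer, oddPart_mul_two_pow_twoVal]

theorem measurable_layer (r : ℕ+) : Measurable (layer r) :=
  measurable_pi_lambda _ fun _ => measurable_pi_apply _

/-- The configuration with given bond variables: in each layer, the first spin is the bond
variable of its site, and the ratio of two neighbours is the bond variable of the second. -/
def build (b : ℕ+ → Spin) : ℕ+ → Spin := fun x => cumProd (layer (oddPart x) b) (twoVal x)

theorem measurable_build : Measurable build :=
  measurable_pi_lambda _ fun x => (measurable_pi_apply (twoVal x)).comp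
    (measurable_cumProd.comp (measurable_layer (oddPart x)))

theorem layer_build (r : OddPNat) (b : ℕ+ → Spin) : layer r (build b) = cumProd (layer r b) := by
  funext k
  rw [layer, build, oddPart_mul_two_pow, twoVal_mul_two_pow]

theorem build_of_odd (r : OddPNat) (b : ℕ+ → Spin) : build b r = b r := by
  have := congrFun (layer_build r b) 0
  simpa [layer, cumProd_zero] using this

theorem build_two_mul (b : ℕ+ → Spin) (x : ℕ+) : build b (2 * x) = build b x * b (2 * x) := by
  have h : 2 * x = (oddPart x : ℕ+) * 2 ^ (twoVal x + 1) := by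
    rw [pow_succ, ← mul_assoc, oddPart_mul_two_pow_twoVal, mul_comm]
  have h1 := congrFun (layer_build (oddPart x) b) (twoVal x + 1)
  have h2 := congrFun (layer_build (oddPart x) b) (twoVal x)
  rw [layer_oddPart_twoVal] at h2
  rw [cumProd_succ, ← h2] at h1
  simpa only [layer, ← h] using h1

/-- The infinite-volume multiplicative Ising measure without field for the coupling `K`: the
spins at odd sites are uniform, and the bond variables are independent. -/
def mulLimit (K : ℝ) : ProbabilityMeasure (ℕ+ → Spin) :=
  ⟨(Measure.infinitePi fun x : ℕ+ => bondLaw (if Odd (x : ℕ) then 0 else K)).map build,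
    Measure.isProbabilityMeasure_map measurable_build.aemeasurable⟩

theorem measurable_layers : Measurable fun (σ : ℕ+ → Spin) (r : OddPNat) => layer r σ :=
  measurable_pi_lambda _ fun r => measurable_layer r

/-- Jointly, the layers are independent half-line Ising chains. -/
theorem map_layers_mulLimit (K : ℝ) :
    (mulLimit K : Measure (ℕ+ → Spin)).map (fun σ (r : OddPNat) => layer r σ)
      = Measure.infinitePi fun _ : OddPNat => (isingLimit K : Measure (ℕ → Spin)) := by
  have hodd : ∀ p : OddPNat × ℕ, (if Odd (siteEquiv p : ℕ) then (0 : ℝ) else K)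
      = if p.2 = 0 then 0 else K := by
    rintro ⟨r, k⟩
    have : Odd (siteEquiv (r, k) : ℕ) ↔ k = 0 := by
      change Odd (((r : ℕ+) * 2 ^ k : ℕ+) : ℕ) ↔ _
      rw [PNat.mul_coe, PNat.pow_coe, Nat.odd_mul, PNat.val_ofNat]
      cases k with
      | zero => simp [r.2]
      | succ k => simp [Nat.even_pow]
    simp only [this]
  have h1 := Measure.map_infinitePi_infinitePi_of_inj
    (P := fun x : ℕ+ => bondLaw (if Odd (x : ℕ) then 0 else K)) siteEquiv.injective
  simp only [hodd] at h1
  have h2 := Measure.infinitePi_map_curry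
    fun (_ : OddPNat) (k : ℕ) => bondLaw (if k = 0 then 0 else K)
  rw [← h1, Measure.map_map (by fun_prop) (by fun_prop)] at h2
  have h3 := Measure.infinitePi_map_pi
    (fun _ : OddPNat => Measure.infinitePi fun k : ℕ => bondLaw (if k = 0 then 0 else K))
    (fun _ => measurable_cumProd)
  have hc : Measurable fun (x : OddPNat → ℕ → Spin) r => cumProd (x r) :=
    measurable_pi_lambda _ fun r => measurable_cumProd.comp (measurable_pi_apply r)
  rw [← h2, Measure.map_map hc (by fun_prop)] at h3
  refine Eq.trans ?_ h3
  refine (Measure.map_map measurable_layers measurable_build).trans ?_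
  congr 1
  funext b r
  exact layer_build r b

theorem measurePreserving_layer (K : ℝ) (r : OddPNat) :
    MeasurePreserving (layer r) (mulLimit K : Measure (ℕ+ → Spin))
      (isingLimit K : Measure (ℕ → Spin)) := by
  refine ⟨measurable_layer r, ?_⟩
  rw [← Measure.infinitePi_map_eval (fun _ : OddPNat => (isingLimit K : Measure (ℕ → Spin))) r,
    ← map_layers_mulLimit, Measure.map_map (measurable_pi_apply r) measurable_layers]
  rfl

theorem iIndepFun_layer (K : ℝ) :
    iIndepFun (fun (r : OddPNat) (σ : ℕ+ → Spin) => layer r σ)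
      (mulLimit K : Measure (ℕ+ → Spin)) := by
  rw [iIndepFun_iff_map_fun_eq_infinitePi_map (fun r : OddPNat => measurable_layer (r : ℕ+)),
    map_layers_mulLimit]
  simp only [(measurePreserving_layer K _).map_eq]

/-! ### Multiplication invariance -/

theorem cyl_shift (m : ℕ) (ξ : ℕ → Spin) :
    (fun (τ : ℕ → Spin) n => τ (n + 1)) ⁻¹' cyl (Finset.range m) ξ
      = ⋃ s : Spin, cyl (Finset.range (m + 1)) fun n => Nat.casesOn n s ξ := by
  ext τ
  simp only [cyl, Finset.mem_range, Set.mem_preimage, Set.mem_ofPred_eq, Set.mem_iUnion]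
  constructor
  · intro h
    refine ⟨τ 0, ?_⟩
    rintro (_ | n) hn
    · rfl
    · exact h n (by omega)
  · rintro ⟨s, h⟩ n hn
    exact h (n + 1) (by omega)

/-- The half-line Ising chain is stationary. -/
theorem measurePreserving_shift_isingLimit (K : ℝ) :
    MeasurePreserving (fun (τ : ℕ → Spin) n => τ (n + 1)) (isingLimit K : Measure (ℕ → Spin))
      (isingLimit K : Measure (ℕ → Spin)) := by
  have hm : Measurable fun (τ : ℕ → Spin) n => τ (n + 1) :=
    measurable_pi_lambda _ fun n => measurable_pi_apply (n + 1)
  refine ⟨hm, ?_⟩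
  have : IsProbabilityMeasure ((isingLimit K : Measure (ℕ → Spin)).map
    fun (τ : ℕ → Spin) n => τ (n + 1)) := Measure.isProbabilityMeasure_map hm.aemeasurable
  refine ext_of_cyl fun D => ⟨Finset.range (D.sup id + 1), fun x hx => ?_, fun ξ => ?_⟩
  · exact Finset.mem_range.2 (Nat.lt_succ_of_le (Finset.le_sup (f := id) hx))
  have hC : Real.cosh K ≠ 0 := (Real.cosh_pos K).ne'
  rw [map_measureReal_apply hm (measurableSet_cyl _ _), cyl_shift, measureReal_iUnion_fintype]
  · simp only [isingLimit_real_cyl, Finset.sum_range_succ' _ (D.sup id)]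
    simp only [mul_add, Real.exp_add, ← sv_mul, exp_mul_sv K (_ * ξ 0), pow_succ]
    simp [UnitsInt.univ, sv]
    field_simp
    ring
  · intro s t hst
    refine Set.disjoint_left.2 fun τ hs ht => hst ?_
    exact (hs 0 (by simp)).symm.trans (ht 0 (by simp))
  · exact fun s => measurableSet_cyl _ _

theorem measurePreserving_shift_iterate (K : ℝ) (a : ℕ) :
    MeasurePreserving (fun (τ : ℕ → Spin) n => τ (n + a)) (isingLimit K : Measure (ℕ → Spin))
      (isingLimit K : Measure (ℕ → Spin)) := by
  induction a with
  | zero => exact MeasurePreserving.id (isingLimit K : Measure (ℕ → Spin))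
  | succ a ih =>
    have h : (fun (τ : ℕ → Spin) n => τ (n + (a + 1)))
        = (fun τ n => τ (n + 1)) ∘ fun (τ : ℕ → Spin) n => τ (n + a) := by
      funext τ n
      exact congrArg τ (by omega)
    exact h ▸ (measurePreserving_shift_isingLimit K).comp ih

theorem measurePreserving_mulShift (K : ℝ) (i : ℕ+) :
    MeasurePreserving (mulShift i) (mulLimit K : Measure (ℕ+ → Spin))
      (mulLimit K : Measure (ℕ+ → Spin)) := by
  have hm : Measurable (mulShift i) := measurable_pi_lambda _ fun j => measurable_pi_apply (i * j)
  refine ⟨hm, ?_⟩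
  -- `g r` is the layer of the original configuration that becomes layer `r`
  let g : OddPNat → OddPNat := fun r => ⟨oddPart i * r, by
    rw [PNat.mul_coe]
    exact (oddPart i).2.mul r.2⟩
  have hg : Function.Injective g := fun r r' h => by
    have := congrArg Subtype.val h
    exact Subtype.ext (mul_left_cancel this)
  have hlayer : ∀ (r : OddPNat) (σ : ℕ+ → Spin),
      layer r (mulShift i σ) = fun n => layer (g r) σ (n + twoVal i) := by
    intro r σ
    funext n
    simp only [layer, mulShift, g]
    congr 1
    conv_lhs => rw [← oddPart_mul_two_pow_twoVal i]
    rw [pow_add]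
    ac_rfl
  have hlaw : ∀ r : OddPNat, MeasurePreserving (fun σ n => layer (g r) σ (n + twoVal i))
      (mulLimit K : Measure (ℕ+ → Spin)) (isingLimit K : Measure (ℕ → Spin)) := fun r =>
    (measurePreserving_shift_iterate K (twoVal i)).comp (measurePreserving_layer K (g r))
  have hind : iIndepFun (fun (r : OddPNat) σ n => layer (g r) σ (n + twoVal i))
      (mulLimit K : Measure (ℕ+ → Spin)) :=
    ((iIndepFun_layer K).precomp hg).comp (fun _ (τ : ℕ → Spin) n => τ (n + twoVal i))
      fun _ => (measurePreserving_shift_iterate K (twoVal i)).measurable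
  have h1 : (mulLimit K : Measure (ℕ+ → Spin)).map (fun σ (r : OddPNat) => layer r (mulShift i σ))
      = (mulLimit K : Measure (ℕ+ → Spin)).map fun σ (r : OddPNat) => layer r σ := by
    simp only [hlayer]
    rw [hind.map_fun_eq_infinitePi_map fun r => (hlaw r).measurable, map_layers_mulLimit]
    simp only [(hlaw _).map_eq]
  -- a configuration is recovered from its layers
  have hasm : Measurable fun (τ : OddPNat → ℕ → Spin) (x : ℕ+) => τ (oddPart x) (twoVal x) :=
    measurable_pi_lambda _ fun x =>
      (measurable_pi_apply (twoVal x)).comp (measurable_pi_apply (oddPart x))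
  have h2 := congrArg (Measure.map fun (τ : OddPNat → ℕ → Spin) (x : ℕ+) =>
    τ (oddPart x) (twoVal x)) h1
  have hlm : Measurable fun σ (r : OddPNat) => layer r (mulShift i σ) := measurable_layers.comp hm
  rw [Measure.map_map hasm hlm, Measure.map_map hasm measurable_layers]
    at h2
  simpa [Function.comp_def, layer_oddPart_twoVal] using h2

/-! ### Convergence of the multiplicative model -/

theorem odd_or_exists_eq_two_mul (x : ℕ+) : Odd (x : ℕ) ∨ ∃ y : ℕ+, x = 2 * y := by
  rcases Nat.even_or_odd (x : ℕ) with ⟨m, hm⟩ | h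
  · have hpos : 0 < m := by have := x.pos; omega
    refine Or.inr ⟨⟨m, hpos⟩, PNat.eq ?_⟩
    change (x : ℕ) = 2 * m
    omega
  · exact Or.inl h

theorem le_two_mul (N : ℕ+) : N ≤ 2 * N := le_mul_of_one_le_left' one_le

theorem exists_subset_Icc (D : Finset ℕ+) : ∃ N, D ⊆ Finset.Icc 1 N := by
  obtain ⟨N, hN⟩ := D.bddAbove
  exact ⟨N, fun x hx => Finset.mem_Icc.2 ⟨one_le, hN hx⟩⟩

theorem not_odd_two_mul (y : ℕ+) : ¬ Odd ((2 * y : ℕ+) : ℕ) := by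
  simp

open Classical in
/-- The bond variables of a configuration: the spin itself at an odd site, and
`σ_y σ_{2y}` at the site `2y`. -/
def bonds (σ : ℕ+ → Spin) (x : ℕ+) : Spin :=
  if h : ∃ y, x = 2 * y then σ h.choose * σ x else σ x

theorem bonds_two_mul (σ : ℕ+ → Spin) (y : ℕ+) : bonds σ (2 * y) = σ y * σ (2 * y) := by
  have h : ∃ z, 2 * y = 2 * z := ⟨y, rfl⟩
  rw [bonds, dif_pos h, ← mul_left_cancel h.choose_spec]

theorem bonds_of_odd (σ : ℕ+ → Spin) {x : ℕ+} (hx : Odd (x : ℕ)) : bonds σ x = σ x := by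
  rw [bonds, dif_neg]
  rintro ⟨y, rfl⟩
  exact not_odd_two_mul y hx

/-- The boxes `[1, M]` contain `x` whenever they contain `2 x`, so the spins in such a box
determine the bond variables in it, and conversely. -/
theorem build_mem_cyl_iff (M : ℕ+) (ξ b : ℕ+ → Spin) :
    build b ∈ cyl (Finset.Icc 1 M) ξ ↔ b ∈ cyl (Finset.Icc 1 M) (bonds ξ) := by
  have hlt : ∀ y : ℕ+, y < 2 * y := fun y => by
    rw [← PNat.coe_lt_coe, PNat.mul_coe, PNat.val_ofNat]
    have := y.pos
    omega
  simp only [cyl, Set.mem_ofPred_eq, Finset.mem_Icc, one_le, true_and]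
  constructor
  · intro h x hx
    rcases odd_or_exists_eq_two_mul x with ho | ⟨y, rfl⟩
    · rw [bonds_of_odd ξ ho, ← h x hx, build_of_odd ⟨x, ho⟩]
    · rw [bonds_two_mul, ← h _ hx, ← h y ((hlt y).le.trans hx), build_two_mul, ← mul_assoc,
        Int.units_mul_self, one_mul]
  · intro h x
    induction x using PNat.strongInductionOn with
    | _ x ih =>
      intro hx
      rcases odd_or_exists_eq_two_mul x with ho | ⟨y, rfl⟩
      · rw [build_of_odd ⟨x, ho⟩, h x hx, bonds_of_odd ξ ho]
      · rw [build_two_mul, ih y (hlt y) ((hlt y).le.trans hx), h _ hx, bonds_two_mul, ← mul_assoc,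
          Int.units_mul_self, one_mul]

/-- The marginal of the limit measure on `[1, 2N]` is the free Boltzmann measure. -/
theorem mulLimit_real_cyl (K : ℝ) (N : ℕ+) : ∃ C : ℝ, 0 < C ∧ ∀ ξ : ℕ+ → Spin,
    (mulLimit K : Measure (ℕ+ → Spin)).real (cyl (Finset.Icc 1 (2 * N)) ξ)
      = C * Real.exp (K * ∑ i ∈ Finset.Icc 1 N, sv (ξ i) * sv (ξ (2 * i))) := by
  refine ⟨∏ x ∈ Finset.Icc 1 (2 * N), (2 * Real.cosh (if Odd (x : ℕ) then 0 else K))⁻¹,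
    Finset.prod_pos fun x _ => inv_pos.2 (mul_pos two_pos (Real.cosh_pos _)), fun ξ => ?_⟩
  refine (map_bonds_real_cyl _ measurable_build (build_mem_cyl_iff (2 * N) ξ)).trans ?_
  congr 2
  rw [Finset.mul_sum]
  symm
  refine Finset.sum_of_injOn (fun i => 2 * i) (fun x _ y _ h => mul_left_cancel h) ?_ ?_ ?_
  · intro x hx
    simp only [Finset.coe_Icc, Set.mem_Icc, one_le, true_and] at hx ⊢
    exact mul_le_mul_right hx 2
  · intro x hx hx'
    rcases odd_or_exists_eq_two_mul x with ho | ⟨y, rfl⟩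
    · rw [if_pos ho, zero_mul]
    · refine absurd ⟨y, ?_, rfl⟩ hx'
      simp only [Finset.mem_Icc, Finset.coe_Icc, Set.mem_Icc, one_le, true_and] at hx ⊢
      exact le_of_mul_le_mul_left' hx
  · intro x _
    rw [if_neg (not_odd_two_mul x), bonds_two_mul, sv_mul]

/-- The positions in the layer `r` of the sites in `D`. -/
def layerSites (D : Finset ℕ+) (r : OddPNat) : Finset ℕ :=
  (D.filter fun x => oddPart x = r).image twoVal

theorem mem_cyl_iff_forall_layer {D : Finset ℕ+} {R : Finset OddPNat}
    (hD : ∀ x ∈ D, oddPart x ∈ R) (ξ σ : ℕ+ → Spin) :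
    σ ∈ cyl D ξ ↔ ∀ r ∈ R, layer r σ ∈ cyl (layerSites D r) (layer r ξ) := by
  constructor
  · intro h r _ n hn
    obtain ⟨x, hx, rfl⟩ := Finset.mem_image.1 hn
    obtain ⟨hxD, rfl⟩ := Finset.mem_filter.1 hx
    rw [layer_oddPart_twoVal, layer_oddPart_twoVal, h x hxD]
  · intro h x hx
    have := h (oddPart x) (hD x hx) (twoVal x)
      (Finset.mem_image.2 ⟨x, Finset.mem_filter.2 ⟨hx, rfl⟩, rfl⟩)
    rwa [layer_oddPart_twoVal, layer_oddPart_twoVal] at this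

/-- Since the layers are independent, the expectation of a product over sites factorises. -/
theorem integral_cyl_mul_prod (K : ℝ) {D L : Finset ℕ+} {R : Finset OddPNat}
    (hD : ∀ x ∈ D, oddPart x ∈ R) (hL : ∀ x ∈ L, oddPart x ∈ R) (ξ : ℕ+ → Spin) (a : ℕ+ → ℝ) :
    ∫ σ, (cyl D ξ).indicator (fun _ => 1) σ * ∏ i ∈ L, (1 + a i * sv (σ i))
        ∂(mulLimit K : Measure (ℕ+ → Spin))
      = ∏ r ∈ R, ∫ τ, (cyl (layerSites D r) (layer r ξ)).indicator (fun _ => 1) τ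
          * ∏ i ∈ L with oddPart i = r, (1 + a i * sv (τ (twoVal i)))
          ∂(isingLimit K : Measure (ℕ → Spin)) := by
  have hsv : Measurable sv := .of_discrete
  have hmeas : ∀ r : OddPNat, Measurable fun τ : ℕ → Spin =>
      (cyl (layerSites D r) (layer r ξ)).indicator (fun _ => (1 : ℝ)) τ
        * ∏ i ∈ L with oddPart i = r, (1 + a i * sv (τ (twoVal i))) := fun r =>
    (measurable_const.indicator (measurableSet_cyl _ _)).mul <|
      Finset.measurable_fun_prod _ fun i _ =>
        ((hsv.comp (measurable_pi_apply (twoVal i))).const_mul (a i)).const_add 1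
  have hpt : ∀ σ : ℕ+ → Spin,
      (cyl D ξ).indicator (fun _ => (1 : ℝ)) σ * ∏ i ∈ L, (1 + a i * sv (σ i))
        = ∏ r : R, ((cyl (layerSites D r) (layer r ξ)).indicator (fun _ => 1) (layer r σ)
          * ∏ i ∈ L with oddPart i = r, (1 + a i * sv (layer r σ (twoVal i)))) := by
    intro σ
    rw [Finset.prod_coe_sort R fun r =>
      ((cyl (layerSites D r) (layer r ξ)).indicator (fun _ => (1 : ℝ)) (layer r σ)
          * ∏ i ∈ L with oddPart i = r, (1 + a i * sv (layer r σ (twoVal i)))),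
      Finset.prod_mul_distrib]
    congr 1
    · classical
      simp only [Set.indicator_apply, mem_cyl_iff_forall_layer hD]
      rw [Finset.prod_ite_zero, Finset.prod_const_one]
    · rw [← Finset.prod_fiberwise_of_maps_to hL]
      refine Finset.prod_congr rfl fun r _ => Finset.prod_congr rfl fun i hi => ?_
      rw [← (Finset.mem_filter.1 hi).2, layer_oddPart_twoVal]
  simp only [hpt]
  rw [((iIndepFun_layer K).precomp (Subtype.val_injective (p := (· ∈ R)))).integral_fun_prod_comp
    (fun r => (measurable_layer _).aemeasurable) fun r => (hmeas r).aestronglyMeasurable]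
  rw [← Finset.prod_coe_sort R]
  refine Finset.prod_congr rfl fun r _ => ?_
  rw [← (measurePreserving_layer K r).map_eq, integral_map (measurable_layer _).aemeasurable
    (hmeas r).aestronglyMeasurable]

theorem filter_oddPart_of_injOn {L : Finset ℕ+} (hL : Set.InjOn oddPart L) (r : OddPNat) :
    (L.filter fun i => oddPart i = r) = ∅ ∨
      ∃ i ∈ L, oddPart i = r ∧ (L.filter fun i => oddPart i = r) = {i} := by
  rcases (L.filter fun i => oddPart i = r).eq_empty_or_nonempty with h | ⟨i, hi⟩
  · exact Or.inl h
  · obtain ⟨hiL, rfl⟩ := Finset.mem_filter.1 hi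
    refine Or.inr ⟨i, hiL, rfl, Finset.eq_singleton_iff_unique_mem.2 ⟨hi, fun j hj => ?_⟩⟩
    obtain ⟨hjL, hj⟩ := Finset.mem_filter.1 hj
    exact hL hjL hiL hj

/-- The effect on a layer of a field `a` that acts on at most one site per layer. -/
theorem integral_layer_factor (K : ℝ) (E : Finset ℕ) {L : Finset ℕ+} (hL : Set.InjOn oddPart L)
    (r : OddPNat) (ξ : ℕ → Spin) (a : ℕ+ → ℝ) :
    ∫ τ, (cyl E ξ).indicator (fun _ => 1) τ
        * ∏ i ∈ L with oddPart i = r, (1 + a i * sv (τ (twoVal i)))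
        ∂(isingLimit K : Measure (ℕ → Spin))
      = (isingLimit K : Measure (ℕ → Spin)).real (cyl E ξ)
        + ∑ i ∈ L with oddPart i = r, a i * ∫ τ, (cyl E ξ).indicator (fun _ => 1) τ
          * sv (τ (twoVal i)) ∂(isingLimit K : Measure (ℕ → Spin)) := by
  rcases filter_oddPart_of_injOn hL r with h | ⟨i, -, -, h⟩
  · simp only [h, Finset.prod_empty, Finset.sum_empty, mul_one, add_zero]
    exact integral_indicator_one (measurableSet_cyl E ξ)
  · simp only [h, Finset.prod_singleton, Finset.sum_singleton]
    exact integral_cyl_mul_one_add K E ξ (a i) (twoVal i)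

theorem cyl_empty {S : Type*} (ξ : S → Spin) : cyl ∅ ξ = Set.univ := by ext; simp [cyl]

/-- Only the layers that meet `D` contribute to the expectation of an event in `D`. -/
theorem integral_cyl_mul_prod_of_injOn (K : ℝ) (D : Finset ℕ+) {L : Finset ℕ+}
    (hL : Set.InjOn oddPart L) (ξ : ℕ+ → Spin) (a : ℕ+ → ℝ) :
    ∫ σ, (cyl D ξ).indicator (fun _ => 1) σ * ∏ i ∈ L, (1 + a i * sv (σ i))
        ∂(mulLimit K : Measure (ℕ+ → Spin))
      = ∏ r ∈ D.image oddPart,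
        ((isingLimit K : Measure (ℕ → Spin)).real (cyl (layerSites D r) (layer r ξ))
          + ∑ i ∈ L with oddPart i = r, a i *
            ∫ τ, (cyl (layerSites D r) (layer r ξ)).indicator (fun _ => 1) τ * sv (τ (twoVal i))
              ∂(isingLimit K : Measure (ℕ → Spin))) := by
  rw [integral_cyl_mul_prod K (R := D.image oddPart ∪ L.image oddPart)
    (fun x hx => Finset.mem_union_left _ (Finset.mem_image_of_mem _ hx))
    (fun x hx => Finset.mem_union_right _ (Finset.mem_image_of_mem _ hx))]
  simp only [integral_layer_factor K _ hL]
  symm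
  refine Finset.prod_subset Finset.subset_union_left fun r _ hr => ?_
  have : layerSites D r = ∅ := by
    rw [layerSites, Finset.image_eq_empty, Finset.filter_eq_empty_iff]
    exact fun x hx h => hr (Finset.mem_image.2 ⟨x, hx, h⟩)
  simp [this, cyl_empty, integral_sv_isingLimit]

/-- Each layer has at most one site in `(N, 2N]`: the next one is twice as large. -/
theorem injOn_oddPart_Icc (N : ℕ+) :
    Set.InjOn oddPart (Finset.Icc (N + 1) (2 * N) : Finset ℕ+) := by
  intro x hx y hy h
  wlog hlt : twoVal x < twoVal y generalizing x y
  · rcases (not_lt.1 hlt).eq_or_lt with h1 | h1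
    · rw [← oddPart_mul_two_pow_twoVal x, ← oddPart_mul_two_pow_twoVal y, h, h1]
    · exact (this hy hx h.symm h1).symm
  exfalso
  simp only [Finset.coe_Icc, Set.mem_Icc] at hx hy
  have h1 : (N : ℕ) + 1 ≤ x := hx.1
  have h2 : (y : ℕ) ≤ 2 * N := hy.2
  have h3 : (y : ℕ) = oddPart x * 2 ^ twoVal y := by
    conv_lhs => rw [← oddPart_mul_two_pow_twoVal y]
    simp [h]
  have h4 : (x : ℕ) = oddPart x * 2 ^ twoVal x := by
    conv_lhs => rw [← oddPart_mul_two_pow_twoVal x]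
    simp
  have h5 : 2 ^ (twoVal x + 1) ≤ 2 ^ twoVal y := Nat.pow_le_pow_right two_pos hlt
  have h6 := Nat.mul_le_mul_left ((oddPart x : ℕ+) : ℕ) h5
  rw [pow_succ, ← mul_assoc, ← h4, ← h3] at h6
  omega

theorem mulHamiltonian_weight (β J c : ℝ) (N : ℕ+) (η σ : ℕ+ → Spin) :
    Real.exp (-mulHamiltonian β J 0 c N η σ)
      = Real.exp (β * J * ∑ i ∈ Finset.Icc 1 N, sv (σ i) * sv (σ (2 * i)))
        * (Real.cosh (β * c) ^ (Finset.Icc (N + 1) (2 * N)).card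
          * ∏ i ∈ Finset.Icc (N + 1) (2 * N),
            (1 + Real.tanh (β * c) * sv (η (2 * i)) * sv (σ i))) := by
  rw [← Finset.prod_const, ← Finset.prod_mul_distrib]
  have h : ∀ i, Real.cosh (β * c) * (1 + Real.tanh (β * c) * sv (η (2 * i)) * sv (σ i))
      = Real.exp (β * c * (sv (η (2 * i)) * sv (σ i))) := fun i => by
    rw [← sv_mul, exp_mul_sv, sv_mul, mul_assoc (Real.tanh _)]
  simp only [h]
  rw [← Real.exp_sum, ← Real.exp_add, ← Finset.mul_sum]
  congr 1
  have h2 : ∀ i, c * sv (σ i) * sv (η (2 * i)) = c * (sv (η (2 * i)) * sv (σ i)) :=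
    fun i => by ring
  simp only [mulHamiltonian, h2, zero_mul, Finset.sum_const_zero, mul_assoc, ← Finset.mul_sum]
  ring

theorem mulMeasure_real_cyl (β J c : ℝ) {N : ℕ+} (η : ℕ+ → Spin) {D : Finset ℕ+}
    (hD : D ⊆ Finset.Icc 1 (2 * N)) (ξ : ℕ+ → Spin) :
    (mulMeasure β J 0 c N η : Measure (ℕ+ → Spin)).real (cyl D ξ)
      = ∏ r ∈ D.image oddPart,
        ((isingLimit (β * J) : Measure (ℕ → Spin)).real (cyl (layerSites D r) (layer r ξ))
          + ∑ i ∈ Finset.Icc (N + 1) (2 * N) with oddPart i = r,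
            Real.tanh (β * c) * sv (η (2 * i)) *
            ∫ τ, (cyl (layerSites D r) (layer r ξ)).indicator (fun _ => 1) τ * sv (τ (twoVal i))
              ∂(isingLimit (β * J) : Measure (ℕ → Spin))) := by
  obtain ⟨C, hC, hcyl⟩ := mulLimit_real_cyl (β * J) N
  refine (finiteVolume_real_cyl_of_density (mulLimit (β * J) : Measure (ℕ+ → Spin)) hD
    (G := fun σ => ∏ i ∈ Finset.Icc (N + 1) (2 * N),
      (1 + Real.tanh (β * c) * sv (η (2 * i)) * sv (σ i))) (fun σ τ h => ?_) _
    (C := C⁻¹ * Real.cosh (β * c) ^ (Finset.Icc (N + 1) (2 * N)).card)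
    (mul_ne_zero (inv_ne_zero hC.ne') (pow_ne_zero _ (Real.cosh_pos _).ne'))
    (fun ζ => ?_) ξ).trans ?_
  · refine Finset.prod_congr rfl fun i hi => ?_
    rw [h i (Finset.mem_coe.2 (Finset.mem_Icc.2 ⟨one_le, (Finset.mem_Icc.1 hi).2⟩))]
  · rw [mulHamiltonian_weight, hcyl]
    field_simp
  · -- no layer meets the empty cylinder, so the density has integral `1`
    have hone := integral_cyl_mul_prod_of_injOn (β * J) ∅ (injOn_oddPart_Icc N) 1
      fun i => Real.tanh (β * c) * sv (η (2 * i))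
    simp only [cyl_empty, Set.indicator_univ, one_mul, Finset.image_empty,
      Finset.prod_empty] at hone
    rw [hone, div_one]
    exact integral_cyl_mul_prod_of_injOn (β * J) D (injOn_oddPart_Icc N) ξ
      fun i => Real.tanh (β * c) * sv (η (2 * i))

/-- The boundary term of a layer vanishes in the limit, because the last site of the layer
inside `[1, 2N]` moves to infinity. -/
theorem tendsto_boundary_term (K c : ℝ) (hc : |c| ≤ 1) (η : ℕ+ → Spin) (r : OddPNat)
    (E : Finset ℕ) (ξ : ℕ → Spin) :
    Tendsto (fun N : ℕ+ => ∑ i ∈ Finset.Icc (N + 1) (2 * N) with oddPart i = r,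
      c * sv (η (2 * i)) * ∫ τ, (cyl E ξ).indicator (fun _ => 1) τ * sv (τ (twoVal i))
        ∂(isingLimit K : Measure (ℕ → Spin))) atTop (𝓝 0) := by
  rw [Metric.tendsto_atTop]
  intro ε hε
  obtain ⟨M, hM⟩ := Metric.tendsto_atTop.1 (tendsto_integral_cyl_mul_sv K E ξ) ε hε
  refine ⟨(r : ℕ+) * 2 ^ M, fun N hN => ?_⟩
  rcases filter_oddPart_of_injOn (injOn_oddPart_Icc N) r with h | ⟨i, hi, hir, h⟩
  · simpa [h] using hε
  · -- the site `r 2 ^ k` in `(N, 2N]` has `k ≥ M` because `N ≥ r 2 ^ M`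
    have hMi : M ≤ twoVal i := by
      by_contra! hlt
      have h1 : N + 1 ≤ i := (Finset.mem_Icc.1 hi).1
      have h2 : (r : ℕ+) * 2 ^ twoVal i ≤ (r : ℕ+) * 2 ^ M :=
        mul_le_mul_right (pow_le_pow_right' one_le hlt.le) _
      rw [← hir, oddPart_mul_two_pow_twoVal, hir] at h2
      exact absurd (h1.trans (h2.trans hN)) (not_le.2 (PNat.lt_add_right N 1))
    have h1 := hM _ hMi
    rw [dist_zero_right, Real.norm_eq_abs] at h1 ⊢
    rw [h, Finset.sum_singleton, abs_mul, abs_mul, abs_sv, mul_one]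
    exact (mul_le_of_le_one_left (abs_nonneg _) hc).trans_lt h1

theorem tendsto_mulMeasure_real_cyl (β J c : ℝ) (η : ℕ+ → Spin) (D : Finset ℕ+)
    (ξ : ℕ+ → Spin) :
    Tendsto (fun N : ℕ+ => (mulMeasure β J 0 c N η : Measure (ℕ+ → Spin)).real (cyl D ξ)) atTop
      (𝓝 ((mulLimit (β * J) : Measure (ℕ+ → Spin)).real (cyl D ξ))) := by
  have hlim := integral_cyl_mul_prod_of_injOn (β * J) D (L := ∅) (by simp) ξ 0
  simp only [Finset.prod_empty, mul_one, Finset.filter_empty, Finset.sum_empty] at hlim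
  have hprob : (mulLimit (β * J) : Measure (ℕ+ → Spin)).real (cyl D ξ) = _ :=
    (integral_indicator_one (measurableSet_cyl D ξ)).symm.trans hlim
  rw [hprob]
  refine (tendsto_finsetProd (D.image oddPart) fun r _ => tendsto_const_nhds.add
    (tendsto_boundary_term (β * J) (Real.tanh (β * c)) (abs_tanh_lt_one _).le η r
      (layerSites D r) (layer r ξ))).congr' ?_
  obtain ⟨M, hM⟩ := exists_subset_Icc D
  filter_upwards [eventually_ge_atTop M] with N hN
  refine (mulMeasure_real_cyl β J c η (hM.trans (Finset.Icc_subset_Icc_right ?_)) ξ).symm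
  exact hN.trans (le_two_mul N)

theorem tendsto_mulMeasure (β J c : ℝ) (η : ℕ+ → Spin) :
    Tendsto (fun N : ℕ+ => mulMeasure β J 0 c N η) atTop (𝓝 (mulLimit (β * J))) :=
  tendsto_of_tendsto_cyl fun D ξ => tendsto_mulMeasure_real_cyl β J c η D ξ

/-! ### The potential -/

theorem mem_pair_two_mul (i : ℕ+) : i ∈ ({i, 2 * i} : Finset ℕ+) := Finset.mem_insert_self _ _

theorem two_mul_ne (i : ℕ+) : i ≠ 2 * i := fun h => by
  have h' := congrArg PNat.val h
  have := i.pos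
  rw [PNat.mul_coe, PNat.val_ofNat] at h'
  omega

theorem injective_pair : Function.Injective fun i : ℕ+ => ({i, 2 * i} : Finset ℕ+) := by
  intro i j h
  have h' : ({i, 2 * i} : Finset ℕ+) = {j, 2 * j} := h
  have h1 : i ∈ ({j, 2 * j} : Finset ℕ+) := h' ▸ mem_pair_two_mul i
  have h2 : j ∈ ({i, 2 * i} : Finset ℕ+) := h' ▸ mem_pair_two_mul j
  simp only [Finset.mem_insert, Finset.mem_singleton] at h1 h2
  rcases h1 with h1 | h1
  · exact h1
  rcases h2 with h2 | h2
  · exact h2.symm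
  have h3 := congrArg PNat.val h1
  have h4 := congrArg PNat.val h2
  rw [PNat.mul_coe, PNat.val_ofNat] at h3 h4
  have := i.pos
  omega

theorem mulPotential_pair (β J : ℝ) (i : ℕ+) (σ : ℕ+ → Spin) :
    mulPotential β J 0 {i, 2 * i} σ = -(β * J * (sv (σ i) * sv (σ (2 * i)))) := by
  rw [mulPotential, if_neg, if_pos ⟨i, rfl⟩, Finset.prod_pair (two_mul_ne i)]
  · ring
  · rintro ⟨j, hj⟩
    have h := congrArg Finset.card hj
    rw [Finset.card_pair (two_mul_ne i), Finset.card_singleton] at h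
    omega

/-- The Hamiltonian of the potential is a finite sum. -/
theorem potentialHamiltonian_eq_sum (β J : ℝ) {Λ : Finset ℕ+} {M : ℕ+}
    (hΛ : Λ ⊆ Finset.Icc 1 M) (σ : ℕ+ → Spin) :
    potentialHamiltonian (mulPotential β J 0) Λ σ
      = ∑ i ∈ Finset.Icc 1 M, if (({i, 2 * i} : Finset ℕ+) ∩ Λ).Nonempty
        then -(β * J * (sv (σ i) * sv (σ (2 * i)))) else 0 := by
  rw [potentialHamiltonian,
    tsum_eq_sum (s := (Finset.Icc 1 M).image fun i : ℕ+ => ({i, 2 * i} : Finset ℕ+)),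
    Finset.sum_image injective_pair.injOn]
  · simp only [mulPotential_pair]
  · intro A hA
    split_ifs with hne
    · rw [mulPotential]
      split_ifs with h1 h2
      · ring
      · obtain ⟨i, rfl⟩ := h2
        refine absurd (Finset.mem_image.2 ⟨i, Finset.mem_Icc.2 ⟨one_le, ?_⟩, rfl⟩) hA
        obtain ⟨x, hx⟩ := hne
        obtain ⟨hx, hxΛ⟩ := Finset.mem_inter.1 hx
        have hxM := (Finset.mem_Icc.1 (hΛ hxΛ)).2
        simp only [Finset.mem_insert, Finset.mem_singleton] at hx
        rcases hx with rfl | rfl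
        · exact hxM
        · exact (le_two_mul i).trans hxM
      · rfl
    · rfl

theorem dependsOn_potentialHamiltonian (β J : ℝ) {Λ : Finset ℕ+} {M : ℕ+}
    (hΛ : Λ ⊆ Finset.Icc 1 M) :
    DependsOn (potentialHamiltonian (mulPotential β J 0) Λ) (Finset.Icc 1 (2 * M) : Finset ℕ+) := by
  intro σ τ h
  rw [potentialHamiltonian_eq_sum β J hΛ, potentialHamiltonian_eq_sum β J hΛ]
  refine Finset.sum_congr rfl fun i hi => ?_
  have hiM := (Finset.mem_Icc.1 hi).2
  rw [h i (Finset.mem_coe.2 (Finset.mem_Icc.2 ⟨one_le, hiM.trans (le_two_mul M)⟩)),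
    h (2 * i) (Finset.mem_coe.2 (Finset.mem_Icc.2 ⟨one_le, mul_le_mul_right hiM 2⟩))]

theorem measurable_potentialHamiltonian (β J : ℝ) (Λ : Finset ℕ+) :
    Measurable (potentialHamiltonian (mulPotential β J 0) Λ) := by
  obtain ⟨M, hM⟩ := exists_subset_Icc Λ
  exact measurable_of_dependsOn (dependsOn_potentialHamiltonian β J hM)

/-- On `[1, 2N]` the Gibbs specification is the finite-volume measure whose boundary spins are
coupled with the strength `J`. -/
theorem specification_Icc (β J : ℝ) (N : ℕ+) (ω : ℕ+ → Spin) :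
    specification (mulPotential β J 0) (Finset.Icc 1 (2 * N)) ω = mulMeasure β J 0 J N ω := by
  refine finiteVolume_congr fun ζ => ?_
  set σ := glue (Finset.Icc 1 (2 * N)) ω ζ
  rw [potentialHamiltonian_eq_sum β J subset_rfl]
  have h1 : ∀ i ∈ Finset.Icc 1 (2 * N),
      (if (({i, 2 * i} : Finset ℕ+) ∩ Finset.Icc 1 (2 * N)).Nonempty
        then -(β * J * (sv (σ i) * sv (σ (2 * i)))) else 0)
        = -β * (J * sv (σ i) * sv (σ (2 * i))) := by
    intro i hi
    rw [if_pos ⟨i, Finset.mem_inter.2 ⟨mem_pair_two_mul i, hi⟩⟩]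
    ring
  have h2 : Finset.Icc 1 (2 * N) = Finset.Icc 1 N ∪ Finset.Icc (N + 1) (2 * N) := by
    ext i
    simp only [Finset.mem_union, Finset.mem_Icc, one_le, true_and, PNat.add_one_le_iff]
    have := le_two_mul N
    constructor
    · intro h
      rcases le_or_gt i N with h' | h'
      · exact Or.inl h'
      · exact Or.inr ⟨h', h⟩
    · rintro (h | h)
      · exact h.trans this
      · exact h.2
  have h3 : Disjoint (Finset.Icc 1 N) (Finset.Icc (N + 1) (2 * N)) := by
    refine Finset.disjoint_left.2 fun i hi hi' => ?_
    have h := (Finset.mem_Icc.1 hi').1.trans (Finset.mem_Icc.1 hi).2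
    exact absurd h (not_le.2 (PNat.lt_add_right N 1))
  have h4 : ∀ i ∈ Finset.Icc (N + 1) (2 * N), σ (2 * i) = ω (2 * i) := by
    intro i hi
    have : 2 * i ∉ Finset.Icc 1 (2 * N) := by
      intro h
      have h5 : i ≤ N := le_of_mul_le_mul_left' (Finset.mem_Icc.1 h).2
      exact absurd ((Finset.mem_Icc.1 hi).1.trans h5) (not_le.2 (PNat.lt_add_right N 1))
    simp [σ, glue, this]
  rw [Finset.sum_congr rfl h1, ← Finset.mul_sum, h2, Finset.sum_union h3, mulHamiltonian]
  simp only [zero_mul, Finset.sum_const_zero, add_zero]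
  congr 2
  exact Finset.sum_congr rfl fun i hi => by rw [h4 i hi]

/-! ### Uniqueness of the Gibbs measure -/

theorem IsGibbs.eq_mulLimit {β J : ℝ} {ν : ProbabilityMeasure (ℕ+ → Spin)}
    (h : IsGibbs (mulPotential β J 0) ν) : ν = mulLimit (β * J) := by
  refine ProbabilityMeasure.toMeasure_injective (ext_of_cyl fun D => ⟨D, subset_rfl, fun ξ => ?_⟩)
  have hN : ∀ N : ℕ+, (ν : Measure (ℕ+ → Spin)).real (cyl D ξ)
      = ∫ ω, (mulMeasure β J 0 J N ω : Measure (ℕ+ → Spin)).real (cyl D ξ)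
        ∂(ν : Measure (ℕ+ → Spin)) := by
    intro N
    have h1 := h (Finset.Icc 1 (2 * N)) (cyl D ξ) (measurableSet_cyl D ξ)
    simp only [specification_Icc] at h1
    rw [← integral_congr_ae h1, integral_condExp cylinderEvents_le_pi]
    exact (integral_indicator_one (measurableSet_cyl D ξ)).symm
  have hlim : Tendsto (fun N : ℕ+ => ∫ ω, (mulMeasure β J 0 J N ω : Measure (ℕ+ → Spin)).real
      (cyl D ξ) ∂(ν : Measure (ℕ+ → Spin))) atTop
      (𝓝 (∫ _, (mulLimit (β * J) : Measure (ℕ+ → Spin)).real (cyl D ξ)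
        ∂(ν : Measure (ℕ+ → Spin)))) := by
    refine tendsto_integral_filter_of_dominated_convergence (fun _ => 1) ?_ ?_
      (integrable_const 1) (ae_of_all _ fun ω => tendsto_mulMeasure_real_cyl β J J ω D ξ)
    · refine Eventually.of_forall fun N => ?_
      have h1 := h (Finset.Icc 1 (2 * N)) (cyl D ξ) (measurableSet_cyl D ξ)
      simp only [specification_Icc] at h1
      exact integrable_condExp.aestronglyMeasurable.congr h1
    · refine Eventually.of_forall fun N => ae_of_all _ fun ω => ?_
      rw [Real.norm_of_nonneg measureReal_nonneg]
      exact measureReal_le_one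
  simp only [← hN, integral_const, probReal_univ, one_smul] at hlim
  exact tendsto_nhds_unique tendsto_const_nhds hlim

/-! ### The limit is a Gibbs measure -/

theorem integrable_of_dependsOn {S : Type*} [DecidableEq S] (μ : Measure (S → Spin))
    [IsFiniteMeasure μ] {Λ : Finset S} {F : (S → Spin) → ℝ} (hF : DependsOn F Λ) :
    Integrable F μ := by
  rw [eq_comp_restrict_of_dependsOn hF]
  exact Integrable.comp_measurable (μ := μ) (f := Λ.restrict) .of_finite (by fun_prop)

theorem mem_iff_of_measurableSet_cylinderEvents {S : Type*} {Δ : Set S} {B : Set (S → Spin)}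
    (hB : MeasurableSet[cylinderEvents (X := fun _ : S => Spin) Δ] B) {σ τ : S → Spin}
    (h : ∀ x ∈ Δ, σ x = τ x) : σ ∈ B ↔ τ ∈ B := by
  have hle : cylinderEvents (X := fun _ : S => Spin) Δ
      ≤ MeasurableSpace.comap (Δ.domRestrict (π := fun _ => Spin)) MeasurableSpace.pi := by
    refine iSup₂_le fun x hx => ?_
    rintro _ ⟨s, hs, rfl⟩
    exact ⟨(fun u : Δ → Spin => u ⟨x, hx⟩) ⁻¹' s, measurable_pi_apply _ hs, rfl⟩
  obtain ⟨B', -, rfl⟩ := hle B hB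
  have : Δ.domRestrict σ = Δ.domRestrict τ := funext fun x => h x x.2
  simp only [Set.mem_preimage, this]

theorem measurable_cylinderEvents_glue {S : Type*} [DecidableEq S] (Λ : Finset S)
    (ζ : Λ → Spin) :
    Measurable[cylinderEvents (X := fun _ : S => Spin) (Λ : Set S)ᶜ] fun ω => glue Λ ω ζ := by
  refine @measurable_pi_lambda _ _ _ (cylinderEvents (X := fun _ : S => Spin) (Λ : Set S)ᶜ) _ _
    fun x => ?_
  by_cases hx : x ∈ Λ
  · simp only [glue, hx, dite_true]
    exact measurable_const
  · simp only [glue, hx, dite_false]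
    exact measurable_cylinderEvent_apply (by simpa using hx)

theorem measurable_mul_const_config {S : Type*} (κ : S → Spin) :
    Measurable fun σ : S → Spin => σ * κ :=
  measurable_pi_lambda _ fun x =>
    (Measurable.of_discrete (f := fun s : Spin => s * κ x)).comp (measurable_pi_apply x)

/-- Flipping spins in `Λ` changes the energy in `Λ` by minus the change of the exponent in the
cylinder probabilities of a large box. -/
theorem potentialHamiltonian_sub (β J : ℝ) {Λ : Finset ℕ+} {M : ℕ+}
    (hΛ : Λ ⊆ Finset.Icc 1 M) (σ τ : ℕ+ → Spin) (h : ∀ x ∉ Λ, σ x = τ x) :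
    potentialHamiltonian (mulPotential β J 0) Λ σ - potentialHamiltonian (mulPotential β J 0) Λ τ
      = β * J * ∑ i ∈ Finset.Icc 1 M, sv (τ i) * sv (τ (2 * i))
        - β * J * ∑ i ∈ Finset.Icc 1 M, sv (σ i) * sv (σ (2 * i)) := by
  rw [potentialHamiltonian_eq_sum β J hΛ, potentialHamiltonian_eq_sum β J hΛ, Finset.mul_sum,
    Finset.mul_sum, ← Finset.sum_sub_distrib, ← Finset.sum_sub_distrib]
  refine Finset.sum_congr rfl fun i _ => ?_
  split_ifs with hne
  · ring
  · have h1 : ∀ x ∈ ({i, 2 * i} : Finset ℕ+), x ∉ Λ := fun x hx hxΛ =>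
      hne ⟨x, Finset.mem_inter.2 ⟨hx, hxΛ⟩⟩
    rw [h i (h1 i (by simp)), h (2 * i) (h1 (2 * i) (by simp))]
    ring

/-- Under a flip of finitely many spins, the limit measure is quasi-invariant, with the Boltzmann
factor of the energy change as density. -/
theorem map_mul_mulLimit (β J : ℝ) (Λ : Finset ℕ+) {κ : ℕ+ → Spin} (hκ : ∀ x ∉ Λ, κ x = 1) :
    (mulLimit (β * J) : Measure (ℕ+ → Spin)).map (fun σ => σ * κ)
      = (mulLimit (β * J) : Measure (ℕ+ → Spin)).withDensity fun σ =>
        ENNReal.ofReal (Real.exp (potentialHamiltonian (mulPotential β J 0) Λ σ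
          - potentialHamiltonian (mulPotential β J 0) Λ (σ * κ))) := by
  obtain ⟨M, hM⟩ := exists_subset_Icc Λ
  have hm := measurable_mul_const_config κ
  set ρ : (ℕ+ → Spin) → ℝ := fun σ => Real.exp (potentialHamiltonian (mulPotential β J 0) Λ σ
          - potentialHamiltonian (mulPotential β J 0) Λ (σ * κ)) with hρ
  have hdep : ∀ {N : ℕ+}, M ≤ N → DependsOn ρ (Finset.Icc 1 (2 * N) : Finset ℕ+) := by
    intro N hN σ τ h
    have h' : Λ ⊆ Finset.Icc 1 N := hM.trans (Finset.Icc_subset_Icc_right hN)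
    simp only [hρ]
    rw [dependsOn_potentialHamiltonian β J h' h, dependsOn_potentialHamiltonian β J h'
      (x := σ * κ) (y := τ * κ) fun x hx => by rw [Pi.mul_apply, Pi.mul_apply, h x hx]]
  have : IsFiniteMeasure ((mulLimit (β * J) : Measure (ℕ+ → Spin)).withDensity fun σ =>
      ENNReal.ofReal (ρ σ)) :=
    isFiniteMeasure_withDensity_ofReal
      (integrable_of_dependsOn _ (hdep le_rfl)).hasFiniteIntegral
  refine ext_of_cyl fun D => ?_
  obtain ⟨M', hM'⟩ := exists_subset_Icc D
  set N := max M M'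
  refine ⟨Finset.Icc 1 (2 * N), hM'.trans (Finset.Icc_subset_Icc_right
    ((le_max_right M M').trans (le_two_mul N))), fun ξ => ?_⟩
  have hpre : (fun σ : ℕ+ → Spin => σ * κ) ⁻¹' cyl (Finset.Icc 1 (2 * N)) ξ
      = cyl (Finset.Icc 1 (2 * N)) (ξ * κ) := by
    ext σ
    refine forall₂_congr fun x _ => ?_
    change σ x * κ x = ξ x ↔ σ x = ξ x * κ x
    constructor
    · rintro h
      rw [← h, mul_assoc, Int.units_mul_self, mul_one]
    · rintro h
      rw [h, mul_assoc, Int.units_mul_self, mul_one]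
  have hdens : ((mulLimit (β * J) : Measure (ℕ+ → Spin)).withDensity fun σ =>
      ENNReal.ofReal (ρ σ)) (cyl (Finset.Icc 1 (2 * N)) ξ)
        = ENNReal.ofReal (ρ ξ) * (mulLimit (β * J) : Measure (ℕ+ → Spin))
          (cyl (Finset.Icc 1 (2 * N)) ξ) := by
    rw [withDensity_apply _ (measurableSet_cyl _ _), ← setLIntegral_const]
    refine setLIntegral_congr_fun (measurableSet_cyl _ _) fun σ hσ => ?_
    simp only [hdep (le_max_left M M') fun x hx => hσ x hx]
  obtain ⟨C, hC, hcyl⟩ := mulLimit_real_cyl (β * J) N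
  rw [map_measureReal_apply hm (measurableSet_cyl _ _), hpre, hcyl, measureReal_def, hdens,
    ENNReal.toReal_mul, ENNReal.toReal_ofReal (Real.exp_pos _).le, ← measureReal_def, hcyl,
    mul_left_comm, ← Real.exp_add]
  congr 2
  rw [potentialHamiltonian_sub β J (hM.trans (Finset.Icc_subset_Icc_right (le_max_left M M')))
    ξ (ξ * κ) fun x hx => by rw [Pi.mul_apply, hκ x hx, mul_one]]
  ring

theorem integral_comp_mul_mulLimit (β J : ℝ) (Λ : Finset ℕ+) {κ : ℕ+ → Spin}
    (hκ : ∀ x ∉ Λ, κ x = 1) {h : (ℕ+ → Spin) → ℝ} (hh : Measurable h) :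
    ∫ σ, h (σ * κ) ∂(mulLimit (β * J) : Measure (ℕ+ → Spin))
      = ∫ σ, Real.exp (potentialHamiltonian (mulPotential β J 0) Λ σ
          - potentialHamiltonian (mulPotential β J 0) Λ (σ * κ)) * h σ
        ∂(mulLimit (β * J) : Measure (ℕ+ → Spin)) := by
  have hm := measurable_mul_const_config κ
  have hH := measurable_potentialHamiltonian β J Λ
  have hρ : Measurable fun σ => ENNReal.ofReal (Real.exp
      (potentialHamiltonian (mulPotential β J 0) Λ σ
        - potentialHamiltonian (mulPotential β J 0) Λ (σ * κ))) :=
    Measurable.ennreal_ofReal (Measurable.exp (hH.fun_sub (hH.comp hm)))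
  rw [← integral_map hm.aemeasurable hh.aestronglyMeasurable, map_mul_mulLimit β J Λ hκ,
    integral_withDensity_eq_integral_toReal_smul hρ (ae_of_all _ fun _ => ENNReal.ofReal_lt_top)]
  simp only [ENNReal.toReal_ofReal (Real.exp_pos _).le, smul_eq_mul]

theorem glue_mul {S : Type*} [DecidableEq S] (Λ : Finset S) (ω : S → Spin) (κ : Λ → Spin) :
    glue Λ ω (Λ.restrict ω * κ) = ω * glue Λ 1 κ := by
  funext x
  by_cases hx : x ∈ Λ <;> simp [glue, hx]

theorem glue_one_of_notMem {S : Type*} [DecidableEq S] {Λ : Finset S} (κ : Λ → Spin) :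
    ∀ x ∉ Λ, glue Λ 1 κ x = 1 := fun x hx => by simp [glue, hx]

theorem glue_congr {S : Type*} [DecidableEq S] {Λ : Finset S} {ω ω' : S → Spin}
    (h : ∀ x ∉ Λ, ω x = ω' x) (κ : Λ → Spin) : glue Λ ω κ = glue Λ ω' κ := by
  funext x
  by_cases hx : x ∈ Λ
  · simp [glue, hx]
  · simp [glue, hx, h x hx]

/-- A sum over the spins in `Λ` as a sum over the flips of spins in `Λ`. -/
theorem sum_glue_eq_sum_flip {S : Type*} [DecidableEq S] (Λ : Finset S) (ω : S → Spin)
    (F : (S → Spin) → ℝ) : ∑ ζ, F (glue Λ ω ζ) = ∑ κ : Λ → Spin, F (ω * glue Λ 1 κ) := by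
  rw [← Equiv.sum_comp (Equiv.mulLeft (Λ.restrict ω : Λ → Spin))]
  simp only [Equiv.coe_mulLeft, glue_mul]

theorem isGibbs_mulLimit (β J : ℝ) : IsGibbs (mulPotential β J 0) (mulLimit (β * J)) := by
  intro Λ A hA
  obtain ⟨M, hM⟩ := exists_subset_Icc Λ
  set H := potentialHamiltonian (mulPotential β J 0) Λ
  set μ := (mulLimit (β * J) : Measure (ℕ+ → Spin))
  have hH : Measurable H := measurable_potentialHamiltonian β J Λ
  have hHdep := dependsOn_potentialHamiltonian β J hM
  -- the partition function
  let Z : (ℕ+ → Spin) → ℝ := fun ω => ∑ ζ, Real.exp (-H (glue Λ ω ζ))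
  have hZpos : ∀ ω, 0 < Z ω := fun ω =>
    Finset.sum_pos (fun _ _ => Real.exp_pos _) Finset.univ_nonempty
  have hγ : ∀ ω, (specification (mulPotential β J 0) Λ ω : Measure (ℕ+ → Spin)).real A
      = (∑ ζ, Real.exp (-H (glue Λ ω ζ)) * A.indicator (fun _ => 1) (glue Λ ω ζ)) / Z ω :=
    fun ω => finiteVolume_real Λ H ω hA
  have hγm : Measurable[cylinderEvents (X := fun _ : ℕ+ => Spin) (Λ : Set ℕ+)ᶜ]
      fun ω => (specification (mulPotential β J 0) Λ ω : Measure (ℕ+ → Spin)).real A := by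
    simp only [hγ]
    refine Measurable.div ?_ ?_
    · refine Finset.measurable_fun_sum _ fun ζ _ => ?_
      exact (hH.neg.exp.mul (measurable_const.indicator hA)).comp
        (measurable_cylinderEvents_glue Λ ζ)
    · refine Finset.measurable_fun_sum _ fun ζ _ => ?_
      exact hH.neg.exp.comp (measurable_cylinderEvents_glue Λ ζ)
  have hγint : Integrable
      (fun ω => (specification (mulPotential β J 0) Λ ω : Measure (ℕ+ → Spin)).real A) μ := by
    refine Integrable.of_bound (C := 1)
      (hγm.mono cylinderEvents_le_pi le_rfl).aestronglyMeasurable (ae_of_all _ fun ω => ?_)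
    rw [Real.norm_of_nonneg measureReal_nonneg]
    exact measureReal_le_one
  refine (ae_eq_condExp_of_forall_setIntegral_eq cylinderEvents_le_pi
    ((integrable_const (1 : ℝ)).indicator hA) (fun s _ _ => hγint.integrableOn) ?_
    hγm.stronglyMeasurable.aestronglyMeasurable).symm
  intro B hB _
  have hB' : MeasurableSet B := cylinderEvents_le_pi _ hB
  have hflip : ∀ (κ : Λ → Spin) (σ : ℕ+ → Spin), ∀ x ∉ Λ, (σ * glue Λ 1 κ) x = σ x :=
    fun κ σ x hx => by rw [Pi.mul_apply, glue_one_of_notMem κ x hx, mul_one]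
  have hZflip : ∀ (κ : Λ → Spin) (σ : ℕ+ → Spin), Z (σ * glue Λ 1 κ) = Z σ := fun κ σ => by
    simp only [Z, glue_congr (hflip κ σ)]
  have hBflip : ∀ (κ : Λ → Spin) (σ : ℕ+ → Spin), σ * glue Λ 1 κ ∈ B ↔ σ ∈ B := fun κ σ =>
    mem_iff_of_measurableSet_cylinderEvents hB fun x hx => hflip κ σ x (by simpa using hx)
  have hZdep : DependsOn Z (Finset.Icc 1 (2 * M) : Finset ℕ+) := by
    intro σ τ h
    refine Finset.sum_congr rfl fun ζ _ => ?_
    have : H (glue Λ σ ζ) = H (glue Λ τ ζ) := hHdep fun x hx => by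
      by_cases hxΛ : x ∈ Λ
      · simp [glue, hxΛ]
      · simp [glue, hxΛ, h x hx]
    rw [this]
  -- the integrand whose flips add up to the specification
  let F : (ℕ+ → Spin) → ℝ := (A ∩ B).indicator fun σ => Real.exp (-H σ) / Z σ
  have hFm : Measurable F :=
    (hH.neg.exp.div (measurable_of_dependsOn hZdep)).indicator (hA.inter hB')
  have hsum : ∀ σ, B.indicator (fun ω =>
      (specification (mulPotential β J 0) Λ ω : Measure (ℕ+ → Spin)).real A) σ
        = ∑ κ : Λ → Spin, F (σ * glue Λ 1 κ) := by
    intro σ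
    by_cases hσ : σ ∈ B
    · rw [Set.indicator_of_mem hσ, hγ, sum_glue_eq_sum_flip Λ σ fun ω =>
        Real.exp (-H ω) * A.indicator (fun _ => 1) ω, Finset.sum_div]
      refine Finset.sum_congr rfl fun κ _ => ?_
      have h1 := (hBflip κ σ).2 hσ
      by_cases h2 : σ * glue Λ 1 κ ∈ A
      · simp [F, h1, h2, hZflip]
      · simp [F, h2]
    · rw [Set.indicator_of_notMem hσ]
      refine (Finset.sum_eq_zero fun κ _ => ?_).symm
      have h1 := mt (hBflip κ σ).1 hσ
      simp [F, h1]
  have hint : ∀ κ : Λ → Spin,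
      Integrable (fun σ => Real.exp (H σ - H (σ * glue Λ 1 κ)) * F σ) μ := by
    intro κ
    have hdep : DependsOn
        (fun σ => Real.exp (H σ - H (σ * glue Λ 1 κ)) * (Real.exp (-H σ) / Z σ))
        (Finset.Icc 1 (2 * M) : Finset ℕ+) := by
      intro σ τ h
      have h2 : H (σ * glue Λ 1 κ) = H (τ * glue Λ 1 κ) := hHdep fun x hx => by
        rw [Pi.mul_apply, Pi.mul_apply, h x hx]
      have h3 : H σ = H τ := hHdep h
      simp only [h3, hZdep h, h2]
    refine ((integrable_of_dependsOn μ hdep).indicator (hA.inter hB')).congr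
      (ae_of_all _ fun σ => ?_)
    by_cases h : σ ∈ A ∩ B <;> simp [F, h]
  have hint' : ∀ κ : Λ → Spin, Integrable (fun σ => F (σ * glue Λ 1 κ)) μ := by
    intro κ
    have hdep : DependsOn
        (fun σ => Real.exp (-H (σ * glue Λ 1 κ)) / Z (σ * glue Λ 1 κ))
        (Finset.Icc 1 (2 * M) : Finset ℕ+) := by
      intro σ τ h
      have h2 : H (σ * glue Λ 1 κ) = H (τ * glue Λ 1 κ) := hHdep fun x hx => by
        rw [Pi.mul_apply, Pi.mul_apply, h x hx]
      simp only [hZflip, hZdep h, h2]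
    refine ((integrable_of_dependsOn μ hdep).indicator
      (measurable_mul_const_config (glue Λ 1 κ) (hA.inter hB'))).congr (ae_of_all _ fun σ => ?_)
    rfl
  calc ∫ ω in B, (specification (mulPotential β J 0) Λ ω : Measure (ℕ+ → Spin)).real A ∂μ
      = ∫ σ, ∑ κ : Λ → Spin, F (σ * glue Λ 1 κ) ∂μ := by
        rw [← integral_indicator hB']
        simp only [hsum]
    _ = ∑ κ : Λ → Spin, ∫ σ, F (σ * glue Λ 1 κ) ∂μ := integral_finsetSum _ fun κ _ => hint' κ
    _ = ∑ κ : Λ → Spin, ∫ σ, Real.exp (H σ - H (σ * glue Λ 1 κ)) * F σ ∂μ :=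
        Finset.sum_congr rfl fun κ _ =>
          integral_comp_mul_mulLimit β J Λ (glue_one_of_notMem κ) hFm
    _ = ∫ σ, ∑ κ : Λ → Spin, Real.exp (H σ - H (σ * glue Λ 1 κ)) * F σ ∂μ :=
        (integral_finsetSum _ fun κ _ => hint κ).symm
    _ = ∫ σ, B.indicator (A.indicator fun _ => (1 : ℝ)) σ ∂μ := by
        congr 1 with σ
        by_cases h : σ ∈ A ∩ B
        · have h1 : ∀ κ : Λ → Spin, Real.exp (H σ - H (σ * glue Λ 1 κ)) * F σ
              = Real.exp (-H (σ * glue Λ 1 κ)) / Z σ := by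
            intro κ
            simp only [F, Set.indicator_of_mem h]
            rw [← mul_div_assoc, ← Real.exp_add]
            congr 2
            ring
          simp only [h1]
          rw [← Finset.sum_div, ← sum_glue_eq_sum_flip Λ σ fun ω => Real.exp (-H ω),
            div_self (hZpos σ).ne', Set.indicator_of_mem h.2, Set.indicator_of_mem h.1]
        · rw [Set.indicator_indicator, Set.inter_comm, Set.indicator_of_notMem h]
          simp [F, h]
    _ = ∫ σ in B, A.indicator (fun _ => (1 : ℝ)) σ ∂μ := integral_indicator hB'

end MulIsing

end

theorem mainTheorem1 (β J : ℝ) :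
    ∃ (μIsing : ProbabilityMeasure (ℕ → MulIsing.Spin))
      (μM : ProbabilityMeasure (ℕ+ → MulIsing.Spin)),
      -- the half-line standard Ising measure: the unique limit, for any right boundary condition
      (∀ (c : ℝ) (s : MulIsing.Spin) (ν : ProbabilityMeasure (ℕ → MulIsing.Spin)),
        Tendsto (fun N : ℕ => MulIsing.isingMeasure β J 0 c N s) atTop (𝓝 ν) ↔ ν = μIsing) ∧
      -- the unique limit of the finite-volume measures, for any boundary condition
      (∀ (c : ℝ) (η : ℕ+ → MulIsing.Spin) (ν : ProbabilityMeasure (ℕ+ → MulIsing.Spin)),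
        Tendsto (fun N : ℕ+ => MulIsing.mulMeasure β J 0 c N η) atTop (𝓝 ν) ↔ ν = μM) ∧
      -- the limit is the unique Gibbs measure
      (∀ ν : ProbabilityMeasure (ℕ+ → MulIsing.Spin),
        MulIsing.IsGibbs (MulIsing.mulPotential β J 0) ν ↔ ν = μM) ∧
      -- the layers are independent, each a copy of the half-line Ising measure
      iIndepFun (fun (r : {r : ℕ+ // Odd (r : ℕ)}) (σ : ℕ+ → MulIsing.Spin) =>
        MulIsing.layer r.1 σ) (μM : Measure (ℕ+ → MulIsing.Spin)) ∧
      (∀ r : ℕ+, Odd (r : ℕ) →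
        MeasurePreserving (MulIsing.layer r) (μM : Measure (ℕ+ → MulIsing.Spin))
          (μIsing : Measure (ℕ → MulIsing.Spin))) ∧
      -- multiplication invariance
      (∀ i : ℕ+, MeasurePreserving (MulIsing.mulShift i) (μM : Measure (ℕ+ → MulIsing.Spin))
        (μM : Measure (ℕ+ → MulIsing.Spin))) := by
  refine ⟨MulIsing.isingLimit (β * J), MulIsing.mulLimit (β * J), fun c s ν => ?_, fun c η ν => ?_,
    fun ν => ?_, MulIsing.iIndepFun_layer (β * J),
    fun r hr => MulIsing.measurePreserving_layer (β * J) ⟨r, hr⟩,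
    MulIsing.measurePreserving_mulShift (β * J)⟩
  · refine ⟨fun h => tendsto_nhds_unique h (MulIsing.tendsto_isingMeasure β J c s), ?_⟩
    rintro rfl
    exact MulIsing.tendsto_isingMeasure β J c s
  · refine ⟨fun h => tendsto_nhds_unique h (MulIsing.tendsto_mulMeasure β J c η), ?_⟩
    rintro rfl
    exact MulIsing.tendsto_mulMeasure β J c η
  · refine ⟨fun h => h.eq_mulLimit, ?_⟩
    rintro rfl
    exact MulIsing.isGibbs_mulLimit β J
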